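/- Let $k$ be a field, $G$ a (linearly) ordered abelian group, and $k((G))$ the field of power series with coefficients in $k$ and exponents in $G$ (well-ordered support), with its canonical valuation $v$ (the minimum of the support). For a subfield $F\subseteq k((G))$ write $vF\subseteq G$ for its value group and $Fv\subseteq k$ for its residue field (the residue map sends a series of non-negative value to its coefficient at $0$). When $F\subseteq k((G))$, let $F^h$ denote the henselization of $(F,v)$ inside the henselian field $k((G))$, that is, the smallest henselian subfield of $k((G))$ containing $F$. For $z\in k((G))$, let $\mathrm{IC}(F(z)|F,v)$, the implicit constant field, be the relative algebraic closure of $F$ in $F(z)^h$. Let $K$ be a subfield of $k((G))$ such that $(K,v)$ is henselian, and suppose that $K$ contains all monomials $ct^\gamma$ with $c\in Kv$ and $\gamma\in vK$. Let $$z=\sum_{i\in\mathbb N}c_it^{\gamma_i},$$ where $(\gamma_i)_{i\in\mathbb N}$ is a strictly increasing sequence in $G$, every $c_i\in k$ is separable-algebraic over $Kv$, and for each $i$ there is an integer $e_i>0$, prime to the characteristic of $Kv$ (no condition if this characteristic is $0$), with $e_i\gamma_i\in vK$. Coefficients $c_i=0$ are allowed. Then: 1. $K(c_it^{\gamma_i}\mid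 i\in\mathbb N)\subseteq K(z)^h$. Consequently $\gamma_i\in vK(z)$ for every $i$ with $c_i\ne 0$, and if $\gamma_i\in vK$ for all $i$, then $c_i\in K(z)v$ for all $i$. 2. Let $\Gamma\subseteq G$ be the subgroup generated by $vK$ and the $\gamma_i$ with $c_i\neq 0$. If $\Gamma/vK$ is infinite or the field extension $Kv(c_i\mid i\in\mathbb N)\,|\,Kv$ is infinite, then $z$ is transcendental over $K$, $\mathrm{IC}(K(z)|K,v)=K(c_it^{\gamma_i}\mid i\in\mathbb N)$, and (a) $vK(z)=\Gamma$; (b) if $\gamma_i\in vK$ for all $i$, then $K(z)v=Kv(c_i\mid i\in\mathbb N)$. -/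

import Mathlib

open HahnSeries

namespace PowerSeriesField

variable {k G : Type*} [Field k] [AddCommGroup G] [LinearOrder G] [IsOrderedAddMonoid G]

/-! The field `k((G))` is `HahnSeries G k`, written `k⟦G⟧`, with its canonical valuation
`v x = min (support x)`, i.e. `x.orderTop` (which is `⊤` exactly for `x = 0`), and with
`v x = x.order` for `x ≠ 0`. -/

/-- The valuation ring of the canonical valuation of `k((G))`. -/
noncomputable def integers (k G : Type*) [Field k] [AddCommGroup G] [LinearOrder G]
    [IsOrderedAddMonoid G] : Subring (HahnSeries G k) where
  carrier := {x | 0 ≤ x.orderTop}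
  zero_mem' := by simp
  one_mem' := by simp
  add_mem' := by
    intro x y (hx : 0 ≤ x.orderTop) (hy : 0 ≤ y.orderTop)
    exact (le_min hx hy).trans min_orderTop_le_orderTop_add
  neg_mem' := by
    intro x (hx : 0 ≤ x.orderTop)
    change 0 ≤ (-x).orderTop
    rwa [orderTop_neg]
  mul_mem' := by
    intro x y (hx : 0 ≤ x.orderTop) (hy : 0 ≤ y.orderTop)
    change 0 ≤ (x * y).orderTop
    rw [orderTop_mul]
    exact add_nonneg hx hy

theorem mem_integers {x : HahnSeries G k} : x ∈ integers k G ↔ 0 ≤ x.orderTop := Iff.rfl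

/-- The valuation ring of the restriction of the canonical valuation to a subfield. -/
noncomputable def valuationRing (F : Subfield (HahnSeries G k)) : Subring (HahnSeries G k) :=
  F.toSubring ⊓ integers k G

/-- The valued field `(F, v)` is henselian. -/
def IsHenselian (F : Subfield (HahnSeries G k)) : Prop :=
  HenselianLocalRing (valuationRing F)

/-- The value group `vF` of a subfield `F`, a subgroup of `G`. -/
noncomputable def valueGroup (F : Subfield (HahnSeries G k)) : AddSubgroup G where
  carrier := {g | ∃ x ∈ F, x ≠ 0 ∧ x.order = g}
  zero_mem' := ⟨1, one_mem F, one_ne_zero, order_one⟩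
  add_mem' := by
    rintro _ _ ⟨x, hx, hx0, rfl⟩ ⟨y, hy, hy0, rfl⟩
    exact ⟨x * y, mul_mem hx hy, mul_ne_zero hx0 hy0, order_mul hx0 hy0⟩
  neg_mem' := by
    rintro _ ⟨x, hx, hx0, rfl⟩
    refine ⟨x⁻¹, inv_mem hx, inv_ne_zero hx0, ?_⟩
    have h := order_mul hx0 (inv_ne_zero hx0)
    rw [mul_inv_cancel₀ hx0, order_one] at h
    exact (neg_eq_of_add_eq_zero_right h.symm).symm

theorem coeff_zero_mul {x y : HahnSeries G k} (hx : x ∈ integers k G) (hy : y ∈ integers k G) :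
    (x * y).coeff 0 = x.coeff 0 * y.coeff 0 := by
  have h0 : 0 < (x - C (x.coeff 0)).orderTop := by
    refine lt_of_le_of_ne ?_ fun h => ?_
    · refine mem_integers.1 (sub_mem hx (mem_integers.2 ?_))
      by_cases h : x.coeff 0 = 0
      · simp [h]
      · rw [C_apply, orderTop_single h]; exact le_rfl
    · refine coeff_orderTop_ne (x := x - C (x.coeff 0)) (g := 0) h.symm ?_
      simp [C_apply]
  have h1 : ((x - C (x.coeff 0)) * y).coeff 0 = 0 := by
    refine coeff_eq_zero_of_lt_orderTop ?_
    rw [orderTop_mul]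
    exact add_pos_of_pos_of_nonneg h0 hy
  have h2 : x * y = (x - C (x.coeff 0)) * y + C (x.coeff 0) * y := by ring
  rw [h2, coeff_add, h1, zero_add, C_mul_eq_smul, coeff_smul, smul_eq_mul]

/-- The residue map of `k((G))` sends an element `x` of the valuation ring to its coefficient
at `0`; it identifies the residue field `Fv` of a subfield `F` with the following subfield
of `k`. -/
noncomputable def residueField (F : Subfield (HahnSeries G k)) : Subfield k where
  carrier := {a | ∃ x ∈ valuationRing F, x.coeff 0 = a}
  zero_mem' := ⟨0, zero_mem _, rfl⟩
  one_mem' := ⟨1, one_mem _, by simp⟩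
  add_mem' := by
    rintro _ _ ⟨x, hx, rfl⟩ ⟨y, hy, rfl⟩
    exact ⟨x + y, add_mem hx hy, by simp⟩
  neg_mem' := by
    rintro _ ⟨x, hx, rfl⟩
    exact ⟨-x, neg_mem hx, by simp⟩
  mul_mem' := by
    rintro _ _ ⟨x, hx, rfl⟩ ⟨y, hy, rfl⟩
    exact ⟨x * y, mul_mem hx hy, coeff_zero_mul hx.2 hy.2⟩
  inv_mem' := by
    rintro _ ⟨x, hx, rfl⟩
    by_cases h : x.coeff 0 = 0
    · exact ⟨0, zero_mem _, by simp [h]⟩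
    have hx0 : x ≠ 0 := by rintro rfl; simp at h
    have ho : x.orderTop = 0 := le_antisymm (orderTop_le_of_coeff_ne_zero h) hx.2
    have hi : 0 ≤ (x⁻¹).orderTop := by
      have h1 := orderTop_mul x x⁻¹
      rw [mul_inv_cancel₀ hx0, orderTop_one, ho, zero_add] at h1
      exact h1.le
    refine ⟨x⁻¹, ⟨F.inv_mem hx.1, hi⟩, ?_⟩
    have h2 := coeff_zero_mul hx.2 hi
    rw [mul_inv_cancel₀ hx0, coeff_one, if_pos rfl] at h2
    exact eq_inv_of_mul_eq_one_right h2.symm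

/-- The henselization `F^h` of `(F, v)` in the henselian field `k((G))`: the smallest henselian
subfield containing `F`. (Hensel lifts of simple roots are unique, so intersections of henselian
subfields are henselian.) -/
noncomputable def henselization (F : Subfield (HahnSeries G k)) : Subfield (HahnSeries G k) :=
  sInf {E | F ≤ E ∧ IsHenselian E}

/-- The field `F(S)` generated over `F` by a subset `S` of `k((G))`. -/
noncomputable def adjoin (F : Subfield (HahnSeries G k)) (S : Set (HahnSeries G k)) :
    Subfield (HahnSeries G k) :=
  (IntermediateField.adjoin F S).toSubfield

/-- The implicit constant field `IC(F(z)|F, v)`: the relative algebraic closure of `F` in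
`F(z)^h`. -/
noncomputable def implicitConstantField (F : Subfield (HahnSeries G k)) (z : HahnSeries G k) :
    Subfield (HahnSeries G k) :=
  (algebraicClosure F (HahnSeries G k)).toSubfield ⊓ henselization (adjoin F {z})

/-- The family of monomials `c i * t ^ γ i`, for a strictly increasing sequence `γ`. -/
noncomputable def monomials (c : ℕ → k) (γ : ℕ → G) (hγ : StrictMono γ) : SummableFamily G k ℕ where
  toFun i := single (γ i) (c i)
  isPWO_iUnion_support' := by
    have h : (Set.range γ).IsPWO := by
      rw [← Set.image_univ]
      exact (Set.isWF_univ_iff.2 inferInstance).isPWO.image_of_monotone hγ.monotone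
    refine h.mono (Set.iUnion_subset fun i => ?_)
    exact support_single_subset.trans (by simp)
  finite_co_support' g := by
    refine Set.Subsingleton.finite fun i hi j hj => ?_
    have key : ∀ n, (single (γ n) (c n)).coeff g ≠ 0 → g = γ n := fun n hn => by
      by_contra h
      exact hn (coeff_single_of_ne h)
    exact hγ.injective ((key i hi).symm.trans (key j hj))

/-- The power series `∑ i, c i * t ^ γ i`, for a strictly increasing sequence `γ`. -/
noncomputable def powerSeries (c : ℕ → k) (γ : ℕ → G) (hγ : StrictMono γ) : HahnSeries G k :=
  (monomials c γ hγ).hsum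

end PowerSeriesField

/-! Throughout, `LeadEq` (same leading term, with 0 equivalent only to itself) replaces separate
bookkeeping of values and residues.

Part 1. Let E be henselian and contain K(z). Once c_j t^{γ_j} lies in E for all j < i, so does z
minus its i-th partial sum, whose leading term is c_i t^{γ_i} if c_i ≠ 0. Any w in E with this
leading term yields the monomial itself (`single_mem_of_leadEq`). With e = e_i, the constant c_i^e
is a simple root over Kv approximated by w^e t^{-eγ_i}, and w/(c_i t^{γ_i}) is the e-th root with
residue 1 of an element of E. Hensel's lemma puts both in E. The statements on vK(z) and K(z)v
follow because henselizations are immediate (`immediate_henselization`).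

Part 2. Let L be the field generated over K by the monomials. As K contains the leading monomials of
its elements, monomials that are linearly independent over K cannot cancel in leading terms, and
independence survives replacing them by elements with the same leading terms
(`exists_lead_monomial`). If some r algebraic over K were a pseudo-limit of the partial sums, the
argument of part 1 would put the monomials in a henselian immediate extension of K(r). Then [L:K] ≤
[K(r):K] (`finiteDimensional_monomialField`), so Γ/vK and Kv(c_i)|Kv would be finite. Hence no
algebraic element is a pseudo-limit; in particular z is transcendental. Splitting a polynomial over
L into linear factors shows that its values at z and at the partial sums eventually have the same
leading term (`eventually_leadEq_eval`).

Now take a maximal ring of pairs (element, sequence in L) with eventually equal leading terms. Its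
first components form a henselian field containing L and z, immediate over L, in which L is
relatively algebraically closed (`exists_hensel_specialization`). This field contains K(z)^h, which
gives the upper bounds in part 2; part 1 gives the lower ones.

Two general facts support this: the factorization `exists_unit_factorization`, which controls
leading terms after adjoining a Hensel lift, and `Hensel.of_separable`, which makes L henselian. -/

namespace ValuedField

/-! ### Leading terms, integral polynomials and Hensel's condition -/

open Polynomial

variable {W Γ₀ : Type*} [Field W] [LinearOrderedCommGroupWithZero Γ₀] (v : Valuation W Γ₀)

/-- Two elements have the same leading term. -/
def LeadEq (x y : W) : Prop := x = y ∨ v (x - y) < v x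

variable {v}

theorem LeadEq.refl (x : W) : LeadEq v x x := Or.inl rfl

theorem LeadEq.map_eq {x y : W} (h : LeadEq v x y) : v x = v y := by
  rcases h with rfl | h
  · rfl
  · rw [← Valuation.map_neg, neg_sub] at h
    exact (Valuation.map_eq_of_sub_lt v h).symm

theorem LeadEq.symm {x y : W} (h : LeadEq v x y) : LeadEq v y x := by
  have e := h.map_eq
  rcases h with rfl | h
  · exact .refl _
  · right
    rwa [Valuation.map_sub_swap, ← e]

theorem LeadEq.trans {x y z : W} (h : LeadEq v x y) (h' : LeadEq v y z) : LeadEq v x z := by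
  have e := h.map_eq
  rcases h with rfl | h
  · exact h'
  rcases h' with rfl | h'
  · exact Or.inr h
  · right
    rw [← sub_add_sub_cancel x y z]
    exact Valuation.map_add_lt v h (e ▸ h')

theorem LeadEq.mul {x y x' y' : W} (h : LeadEq v x y) (h' : LeadEq v x' y') :
    LeadEq v (x * x') (y * y') := by
  have key : ∀ {a b c : W}, LeadEq v a b → LeadEq v (a * c) (b * c) := by
    rintro a b c (rfl | h)
    · exact .refl _
    · by_cases hc : c = 0
      · left; simp [hc]
      · right
        rw [← sub_mul, map_mul, map_mul]
        exact mul_lt_mul_of_pos_right h (by simpa [zero_lt_iff] using hc)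
  refine (key h).trans ?_
  rw [mul_comm y, mul_comm y]
  exact key h'

/-- This is what lets algebraic identities pass between elements with the same leading term:
vanishing is detected exactly. -/
theorem leadEq_zero_left {y : W} : LeadEq v 0 y ↔ y = 0 := by
  refine ⟨fun h => ?_, fun h => h ▸ .refl _⟩
  have := h.map_eq
  rw [map_zero, eq_comm, Valuation.zero_iff] at this
  exact this

theorem LeadEq.eq_zero_iff {x y : W} (h : LeadEq v x y) : x = 0 ↔ y = 0 := by
  rw [← Valuation.zero_iff v, h.map_eq, Valuation.zero_iff]

theorem LeadEq.inv {x y : W} (h : LeadEq v x y) : LeadEq v x⁻¹ y⁻¹ := by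
  by_cases hx : x = 0
  · rw [h.eq_zero_iff.1 hx, hx]; exact .refl _
  have hy : y ≠ 0 := fun e => hx (h.eq_zero_iff.2 e)
  have := (h.symm.mul (.refl x⁻¹)).mul (.refl y⁻¹)
  rwa [mul_inv_cancel₀ hx, one_mul, mul_right_comm, mul_inv_cancel₀ hy, one_mul] at this

theorem LeadEq.div {x y x' y' : W} (h : LeadEq v x y) (h' : LeadEq v x' y') :
    LeadEq v (x / x') (y / y') := by
  rw [div_eq_mul_inv, div_eq_mul_inv]
  exact h.mul h'.inv

theorem LeadEq.pow {x y : W} (h : LeadEq v x y) (n : ℕ) : LeadEq v (x ^ n) (y ^ n) := by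
  induction n with
  | zero => simpa using .refl _
  | succ n ih => rw [pow_succ, pow_succ]; exact ih.mul h

theorem leadEq_of_sub_lt_one {x y : W} (hx : v x = 1) (h : v (x - y) < 1) : LeadEq v x y :=
  Or.inr (hx ▸ h)

theorem LeadEq.sub_lt_one {x y : W} (h : LeadEq v x y) (hx : v x ≤ 1) : v (x - y) < 1 := by
  rcases h with rfl | h
  · simp
  · exact h.trans_le hx

variable (v)

/-- Polynomials with coefficients in the valuation ring. -/
def IsIntegralPoly (f : W[X]) : Prop := ∀ i, v (f.coeff i) ≤ 1

variable {v}

theorem IsIntegralPoly.exists_lift {f : W[X]} (hf : IsIntegralPoly v f) :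
    ∃ F : v.valuationSubring[X], F.map (algebraMap v.valuationSubring W) = f := by
  have : f ∈ Polynomial.lifts (algebraMap v.valuationSubring W) := by
    rw [Polynomial.lifts_iff_coeff_lifts]
    exact fun i => ⟨⟨f.coeff i, hf i⟩, rfl⟩
  obtain ⟨F, hF⟩ := this
  exact ⟨F, hF⟩

theorem isIntegralPoly_map (F : v.valuationSubring[X]) :
    IsIntegralPoly v (F.map (algebraMap v.valuationSubring W)) := by
  intro i
  rw [Polynomial.coeff_map]
  exact (F.coeff i).2

theorem IsIntegralPoly.derivative {f : W[X]} (hf : IsIntegralPoly v f) :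
    IsIntegralPoly v (derivative f) := by
  obtain ⟨F, rfl⟩ := hf.exists_lift
  rw [Polynomial.derivative_map]
  exact isIntegralPoly_map _

theorem IsIntegralPoly.eval_le {f : W[X]} (hf : IsIntegralPoly v f) {x : W} (hx : v x ≤ 1) :
    v (f.eval x) ≤ 1 := by
  obtain ⟨F, rfl⟩ := hf.exists_lift
  have := Polynomial.eval_map_algebraMap F x
  lift x to v.valuationSubring using hx
  rw [show (x : W) = algebraMap v.valuationSubring W x from rfl, Polynomial.eval_map_apply]
  exact (F.eval x).2

theorem IsIntegralPoly.exists_taylor {f : W[X]} (hf : IsIntegralPoly v f) {x y : W}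
    (hx : v x ≤ 1) (hy : v y ≤ 1) :
    ∃ c, v c ≤ 1 ∧ f.eval x = f.eval y + f.derivative.eval y * (x - y) + c * (x - y) ^ 2 := by
  obtain ⟨F, rfl⟩ := hf.exists_lift
  lift x to v.valuationSubring using hx
  lift y to v.valuationSubring using hy
  obtain ⟨c, hc⟩ := F.binomExpansion y (x - y)
  refine ⟨c, c.2, ?_⟩
  rw [add_sub_cancel] at hc
  rw [Polynomial.derivative_map]
  have := congrArg (algebraMap v.valuationSubring W) hc
  rw [← Polynomial.eval_map_apply, map_add, map_add, map_mul, map_mul, map_pow,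
    ← Polynomial.eval_map_apply, ← Polynomial.eval_map_apply, map_sub] at this
  exact this

theorem IsIntegralPoly.eval_sub_le {f : W[X]} (hf : IsIntegralPoly v f) {x y : W}
    (hx : v x ≤ 1) (hy : v y ≤ 1) : v (f.eval x - f.eval y) ≤ v (x - y) := by
  obtain ⟨c, hc, h⟩ := hf.exists_taylor hx hy
  have : f.eval x - f.eval y = (f.derivative.eval y + c * (x - y)) * (x - y) := by
    rw [h]; ring
  rw [this, map_mul]
  refine mul_le_of_le_one_left' (Valuation.map_add_le v (hf.derivative.eval_le hy) ?_)
  rw [map_mul]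
  exact mul_le_one' hc ((Valuation.map_sub v _ _).trans (max_le hx hy))

theorem le_one_of_sub_lt {x y : W} (hy : v y ≤ 1) (h : v (x - y) < 1) : v x ≤ 1 := by
  rw [← sub_add_cancel x y]
  exact Valuation.map_add_le v h.le hy

theorem IsIntegralPoly.eval_eq_one {f : W[X]} (hf : IsIntegralPoly v f) {x y : W}
    (hy : v y ≤ 1) (h : v (x - y) < 1) (h1 : v (f.eval y) = 1) : v (f.eval x) = 1 := by
  have h2 := (hf.eval_sub_le (le_one_of_sub_lt hy h) hy).trans_lt h
  rw [← h1] at h2 ⊢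
  exact Valuation.map_eq_of_sub_lt v h2

theorem IsIntegralPoly.eval_lt_one {f : W[X]} (hf : IsIntegralPoly v f) {x y : W}
    (hy : v y ≤ 1) (h : v (x - y) < 1) (h1 : v (f.eval y) < 1) : v (f.eval x) < 1 := by
  have h2 := (hf.eval_sub_le (le_one_of_sub_lt hy h) hy).trans_lt h
  rw [← sub_add_cancel (f.eval x) (f.eval y)]
  exact Valuation.map_add_lt v h2 h1

/-- A simple residual root lifts to at most one root. -/
theorem IsIntegralPoly.root_unique {f : W[X]} (hf : IsIntegralPoly v f) {x y : W}
    (hx : f.eval x = 0) (hy : f.eval y = 0) (hv : v y ≤ 1) (h : v (x - y) < 1)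
    (h1 : v (f.derivative.eval y) = 1) : x = y := by
  obtain ⟨c, hc, h2⟩ := hf.exists_taylor (le_one_of_sub_lt hv h) hv
  have h3 : (f.derivative.eval y + c * (x - y)) * (x - y) = 0 := by
    linear_combination hx - h2 - hy
  rcases mul_eq_zero.1 h3 with h4 | h4
  · rw [eq_neg_of_add_eq_zero_left h4, Valuation.map_neg, map_mul] at h1
    exact absurd h1 ((mul_le_of_le_one_left' hc).trans_lt h).ne
  · exact sub_eq_zero.1 h4

variable (v)

/-- The valued field `(E, v)` is henselian. -/
def Hensel (E : Subfield W) : Prop :=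
  ∀ f : W[X], f.Monic → (∀ i, f.coeff i ∈ E) → IsIntegralPoly v f → ∀ a ∈ E, v a ≤ 1 →
    v (f.eval a) < 1 → v (f.derivative.eval a) = 1 → ∃ x ∈ E, f.eval x = 0 ∧ v (x - a) < 1

/-- Every element of `E` has the leading term of an element of `F`. -/
def Immediate (F E : Subfield W) : Prop := ∀ y ∈ E, ∃ d ∈ F, LeadEq v y d

variable {v}

theorem Immediate.trans {F E D : Subfield W} (h : Immediate v F E) (h' : Immediate v E D) :
    Immediate v F D := by
  intro y hy
  obtain ⟨d, hd, h1⟩ := h' y hy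
  obtain ⟨e, he, h2⟩ := h d hd
  exact ⟨e, he, h1.trans h2⟩

/-- The root x is already known in the big field; by uniqueness of lifts, the lift found in E from
the approximation b must be x. -/
theorem Hensel.mem_of_root {E : Subfield W} (hE : Hensel v E) {f : W[X]} (hf : f.Monic)
    (hfE : ∀ i, f.coeff i ∈ E) (hfi : IsIntegralPoly v f) {x b : W} (hx : f.eval x = 0)
    (hb : b ∈ E) (hv : v x ≤ 1) (h : v (x - b) < 1) (h1 : v (f.derivative.eval x) = 1) :
    x ∈ E := by
  have h' : v (b - x) < 1 := by rwa [Valuation.map_sub_swap]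
  have hb1 := le_one_of_sub_lt hv h'
  obtain ⟨y, hy, hy0, hyb⟩ := hE f hf hfE hfi b hb hb1
    (hfi.eval_lt_one hv h' (by simp [hx])) (hfi.derivative.eval_eq_one hv h' h1)
  have : y = x := hfi.root_unique hy0 hx hv (by
    rw [← sub_add_sub_cancel y b x]; exact Valuation.map_add_lt v hyb h') h1
  exact this ▸ hy

/-- An algebraically closed field is henselian with respect to any valuation. -/
theorem hensel_top [IsAlgClosed W] : Hensel v ⊤ := by
  intro f hf _ hfi a _ ha h0 h1
  have hs := IsAlgClosed.splits f
  have h2 : f.eval a = (f.roots.map fun r => a - r).prod := by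
    conv_lhs => rw [hs.eq_prod_roots_of_monic hf]
    simp [Polynomial.eval_multiset_prod]
  rw [h2, map_multiset_prod, Multiset.map_map] at h0
  by_contra! H
  -- f(a) is the product of the a - r over the roots r, so if no factor had value below 1, neither
  -- would f(a).
  refine absurd h0 (not_lt.2 (Multiset.one_le_prod_of_one_le ?_))
  intro c hc
  obtain ⟨r, hr, rfl⟩ := Multiset.mem_map.1 hc
  have := H r trivial (by simpa using (Polynomial.mem_roots'.1 hr).2)
  rwa [Valuation.map_sub_swap] at this

end ValuedField

/-! ### Unit factorization modulo a polynomial with a simple residual root -/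

namespace ValuedField

open Polynomial

section ValuationRing

variable {A : Type*} [CommRing A] [IsDomain A] [ValuationRing A]

theorem exists_dvd_all {ι : Type*} (s : Finset ι) (hs : s.Nonempty) (f : ι → A) :
    ∃ i ∈ s, ∀ j ∈ s, f i ∣ f j := by
  induction hs using Finset.Nonempty.cons_induction with
  | singleton a => exact ⟨a, by simp, by simp⟩
  | cons a s ha hs ih =>
    obtain ⟨i, hi, h⟩ := ih
    rcases ValuationRing.dvd_total (f a) (f i) with h1 | h1
    · refine ⟨a, by simp, fun j hj => ?_⟩
      rcases Finset.mem_cons.1 hj with rfl | hj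
      · exact dvd_rfl
      · exact h1.trans (h j hj)
    · refine ⟨i, by simp [hi], fun j hj => ?_⟩
      rcases Finset.mem_cons.1 hj with rfl | hj
      · exact h1
      · exact h j hj

open IsLocalRing in
/-- Among the linear combinations of finitely many vectors over a valuation ring on which a given
residual functional does not vanish, there is one of maximal content. -/
theorem exists_max_content {J ι : Type*} [Finite ι] [DecidableEq J] (n : ℕ) :
    ∀ (t : Finset J) (w : J → ι → A) (l : J → ResidueField A), t.card = n →
      (∃ j ∈ t, l j ≠ 0) → ∃ s : J → A, ∑ j ∈ t, residue A (s j) * l j ≠ 0 ∧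
        ∀ s' : J → A, ∑ j ∈ t, residue A (s' j) * l j ≠ 0 → ∀ d,
          (∀ i, d ∣ ∑ j ∈ t, s' j * w j i) → ∀ i, d ∣ ∑ j ∈ t, s j * w j i := by
  classical
  cases nonempty_fintype ι
  induction n with
  | zero =>
    rintro t w l ht ⟨j, hj, -⟩
    simp [Finset.card_eq_zero.1 ht] at hj
  | succ n ih =>
    rintro t w l ht ⟨j1, hj1, hl1⟩
    by_cases hι : Nonempty ι
    swap
    · refine ⟨Pi.single j1 1, ?_, fun _ _ _ _ i => (hι ⟨i⟩).elim⟩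
      rw [Finset.sum_eq_single j1] <;> simp +contextual [hj1, hl1]
    -- Gaussian elimination: the pivot divides every entry, so column i0 can be cleared from the
    -- other rows; l' is the functional on the reduced rows.
    obtain ⟨⟨j0, i0⟩, hp, hmin⟩ := exists_dvd_all (t ×ˢ (Finset.univ : Finset ι))
      (⟨(j1, Classical.arbitrary ι), by simp [hj1]⟩) (fun p => w p.1 p.2)
    have hj0 : j0 ∈ t := by simpa using hp
    have hmin' : ∀ j ∈ t, ∀ i, w j0 i0 ∣ w j i := fun j hj i => hmin (j, i) (by simp [hj])
    have hq : ∀ j, ∃ q, j ∈ t → w j i0 = w j0 i0 * q := by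
      intro j
      by_cases hj : j ∈ t
      · obtain ⟨q, hq⟩ := hmin' j hj i0
        exact ⟨q, fun _ => hq⟩
      · exact ⟨0, fun h => absurd h hj⟩
    choose q hq using hq
    set w' : J → ι → A := fun j i => w j i - q j * w j0 i with hw'
    set l' : J → ResidueField A := fun j => l j - residue A (q j) * l j0 with hl'
    have hsum : ∀ (s : J → A) i, ∑ j ∈ t, s j * w j i =
        (s j0 + ∑ j ∈ t.erase j0, s j * q j) * w j0 i + ∑ j ∈ t.erase j0, s j * w' j i := by
      intro s i
      rw [← Finset.add_sum_erase t _ hj0, add_mul, add_assoc, Finset.sum_mul,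
        ← Finset.sum_add_distrib]
      congr 1
      refine Finset.sum_congr rfl fun j _ => ?_
      simp only [hw']; ring
    have hsuml : ∀ (s : J → A), ∑ j ∈ t, residue A (s j) * l j =
        residue A (s j0 + ∑ j ∈ t.erase j0, s j * q j) * l j0 +
          ∑ j ∈ t.erase j0, residue A (s j) * l' j := by
      intro s
      rw [← Finset.add_sum_erase t _ hj0, map_add, map_sum, add_mul, add_assoc, Finset.sum_mul,
        ← Finset.sum_add_distrib]
      congr 1
      refine Finset.sum_congr rfl fun j _ => ?_
      simp only [hl', map_mul]; ring
    have hw0 : ∀ s : J → A, ∑ j ∈ t.erase j0, s j * w' j i0 = 0 := by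
      intro s
      refine Finset.sum_eq_zero fun j hj => ?_
      simp only [hw', hq j (Finset.mem_of_mem_erase hj)]
      ring
    have hunit : ∀ x : A, ∀ d, residue A x ≠ 0 → d ∣ x * w j0 i0 → d ∣ w j0 i0 := by
      intro x d hx hd
      rwa [IsUnit.dvd_mul_left ((residue_ne_zero_iff_isUnit x).1 hx)] at hd
    by_cases hz : ∃ j ∈ t.erase j0, l' j ≠ 0
    · obtain ⟨s, hs, hmax⟩ := ih (t.erase j0) w' l'
        (by rw [Finset.card_erase_of_mem hj0, ht]; rfl) hz
      -- The coefficient of the pivot row is chosen so that this row drops out, leaving the optimal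
      -- combination of reduced rows.
      set s₁ : J → A := Function.update s j0 (-∑ j ∈ t.erase j0, s j * q j) with hs₁
      have hs1 : ∀ j ∈ t.erase j0, s₁ j = s j := fun j hj => by
        simp [hs₁, Finset.ne_of_mem_erase hj]
      have h0 : s₁ j0 + ∑ j ∈ t.erase j0, s₁ j * q j = 0 := by
        rw [Finset.sum_congr rfl fun j hj => by rw [hs1 j hj]]
        simp [hs₁]
      refine ⟨s₁, ?_, fun s' hs' d hd i => ?_⟩
      · rw [hsuml, h0, map_zero, zero_mul, zero_add,
          Finset.sum_congr rfl fun j hj => by rw [hs1 j hj]]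
        exact hs
      rw [hsum, h0, zero_mul, zero_add, Finset.sum_congr rfl fun j hj => by rw [hs1 j hj]]
      have hd0 := hd i0
      rw [hsum, hw0, add_zero] at hd0
      -- If the reduced rows contribute nothing to the functional, the total pivot coefficient is a
      -- unit and d divides the pivot, hence every entry. Otherwise d divides the reduced
      -- combination and the induction hypothesis applies.
      by_cases hl0 : ∑ j ∈ t.erase j0, residue A (s' j) * l' j = 0
      · rw [hsuml, hl0, add_zero] at hs'
        have hd1 := hunit _ d (left_ne_zero_of_mul hs') hd0
        refine Finset.dvd_sum fun j hj => Dvd.dvd.mul_left (dvd_sub ?_ (Dvd.dvd.mul_left ?_ _)) _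
        · exact hd1.trans (hmin' j (Finset.mem_of_mem_erase hj) i)
        · exact hd1.trans (hmin' j0 hj0 i)
      · refine hmax s' hl0 d (fun i => ?_) i
        have := hd i
        rw [hsum] at this
        refine (dvd_add_right ?_).1 this
        exact hd0.trans (mul_dvd_mul_left _ (hmin' j0 hj0 i))
    · push Not at hz
      have hl0 : ∀ s : J → A, ∑ j ∈ t.erase j0, residue A (s j) * l' j = 0 := fun s =>
        Finset.sum_eq_zero fun j hj => by rw [hz j hj, mul_zero]
      have hlj0 : l j0 ≠ 0 := by
        intro h0
        by_cases h : j1 = j0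
        · exact hl1 (h ▸ h0)
        · have := hz j1 (Finset.mem_erase.2 ⟨h, hj1⟩)
          simp only [hl', h0, mul_zero, sub_zero] at this
          exact hl1 this
      refine ⟨Pi.single j0 1, ?_, fun s' hs' d hd i => ?_⟩
      · rw [Finset.sum_eq_single j0] <;> simp +contextual [hj0, hlj0]
      · rw [Finset.sum_eq_single j0 (by simp +contextual) (by simp +contextual [hj0]),
          Pi.single_eq_same, one_mul]
        have hd0 := hd i0
        rw [hsum, hw0, add_zero] at hd0
        rw [hsuml, hl0, add_zero] at hs'
        exact (hunit _ d (left_ne_zero_of_mul hs') hd0).trans (hmin' j0 hj0 i)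

open IsLocalRing in
/-- Modulo a monic polynomial `f` with a simple residual root `a`, every polynomial is a constant
times a quotient of two polynomials that do not vanish residually at `a`. -/
theorem exists_unit_factorization {f : A[X]} (hf : f.Monic) {a : A}
    (h0 : f.eval a ∈ maximalIdeal A) (h1 : IsUnit (f.derivative.eval a)) (g : A[X]) :
    ∃ (s h q : A[X]) (d : A), g * s = Polynomial.C d * h + f * q ∧ IsUnit (s.eval a) ∧
      IsUnit (h.eval a) := by
  classical
  set n := f.natDegree with hn
  have hn0 : n ≠ 0 := by
    intro hn0
    rw [hf.natDegree_eq_zero.1 (hn ▸ hn0), eval_one] at h0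
    exact (maximalIdeal.isMaximal A).ne_top ((Ideal.eq_top_iff_one _).2 h0)
  have hf1 : f ≠ 1 := fun h => hn0 (by rw [hn, h, natDegree_one])
  have hres : residue A (f.eval a) = 0 := (residue_eq_zero_iff _).2 h0
  have hlt : ∀ p : A[X], (p %ₘ f).natDegree < n := fun p => natDegree_modByMonic_lt p hf hf1
  have hpoly : ∀ p : A[X], p.natDegree < n → p = ∑ j : Fin n, Polynomial.C (p.coeff j) * X ^ (j : ℕ) := by
    intro p hp
    rw [Fin.sum_univ_eq_sum_range (fun j => Polynomial.C (p.coeff j) * X ^ j) n]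
    exact p.as_sum_range_C_mul_X_pow' hp
  -- Among the multipliers s of degree below n with s(a) a unit, choose one for which the remainder
  -- of g s modulo f has the largest content.
  obtain ⟨s, hs, hmax⟩ := exists_max_content (A := A) n (Finset.univ : Finset (Fin n))
    (fun j (i : Fin n) => ((g * X ^ (j : ℕ)) %ₘ f).coeff i) (fun j => residue A a ^ (j : ℕ))
    (by simp) ⟨⟨0, Nat.pos_of_ne_zero hn0⟩, by simp, by simp⟩
  have hcoeff : ∀ (s : Fin n → A) (i : ℕ),
      ((g * ∑ j : Fin n, Polynomial.C (s j) * X ^ (j : ℕ)) %ₘ f).coeff i =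
        ∑ j : Fin n, s j * ((g * X ^ (j : ℕ)) %ₘ f).coeff i := by
    intro s i
    have : g * ∑ j : Fin n, Polynomial.C (s j) * X ^ (j : ℕ) = ∑ j : Fin n, s j • (g * X ^ (j : ℕ)) := by
      rw [Finset.mul_sum]
      refine Finset.sum_congr rfl fun j _ => ?_
      rw [smul_eq_C_mul]; ring
    rw [this, ← modByMonicHom_apply, map_sum, finsetSum_coeff]
    refine Finset.sum_congr rfl fun j _ => ?_
    rw [map_smul, modByMonicHom_apply, Polynomial.coeff_smul, smul_eq_mul]
  have heval : ∀ s : Fin n → A, residue A ((∑ j : Fin n, Polynomial.C (s j) * X ^ (j : ℕ)).eval a) =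
      ∑ j : Fin n, residue A (s j) * residue A a ^ (j : ℕ) := by
    intro s
    simp [eval_finsetSum]
  set S : A[X] := ∑ j : Fin n, Polynomial.C (s j) * X ^ (j : ℕ) with hS
  have hSu : residue A (S.eval a) ≠ 0 := by rw [hS, heval]; exact hs
  set R := (g * S) %ₘ f with hR
  have hRdeg : ∀ i, n ≤ i → R.coeff i = 0 := fun i hi =>
    coeff_eq_zero_of_natDegree_lt ((hlt _).trans_le hi)
  have hmod : ∀ p q : A[X], (g * p + f * q) %ₘ f = (g * p) %ₘ f := by
    intro p q
    rw [add_modByMonic, mul_comm f q, mul_self_modByMonic hf, add_zero]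
  have hmax' : ∀ P : A[X], residue A (P.eval a) ≠ 0 → ∀ d, (∀ i, d ∣ ((g * P) %ₘ f).coeff i) →
      ∀ i, d ∣ R.coeff i := by
    intro P hP d hd i
    rcases lt_or_ge i n with hi | hi
    swap
    · rw [hRdeg i hi]; exact dvd_zero d
    have hP' : P = P %ₘ f + f * (P /ₘ f) := (modByMonic_add_div P f).symm
    rw [hR, hS, hcoeff]
    refine hmax (fun j => (P %ₘ f).coeff j) ?_ d (fun i => ?_) ⟨i, hi⟩
    · rw [← heval, ← hpoly _ (hlt P)]
      rw [hP', eval_add, eval_mul, map_add, map_mul, hres, zero_mul, add_zero] at hP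
      exact hP
    · rw [← hcoeff, ← hpoly _ (hlt P)]
      have := hd i
      rwa [hP', mul_add, ← mul_assoc, mul_comm g f, mul_assoc, hmod] at this
  have hgS : g * S = R + f * ((g * S) /ₘ f) := (modByMonic_add_div _ f).symm
  have hSunit : IsUnit (S.eval a) := (residue_ne_zero_iff_isUnit _).1 hSu
  by_cases hR0 : R = 0
  · exact ⟨S, 1, (g * S) /ₘ f, 0, by
      conv_lhs => rw [hgS, hR0]
      simp, hSunit, by simp⟩
  obtain ⟨i0, hi0, hdvd⟩ := exists_dvd_all R.support (by simpa using hR0) R.coeff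
  have hdvd' : ∀ i, R.coeff i0 ∣ R.coeff i := by
    intro i
    by_cases hi : i ∈ R.support
    · exact hdvd i hi
    · rw [notMem_support_iff.1 hi]; exact dvd_zero _
  set D := R.coeff i0 with hD
  have hD0 : D ≠ 0 := mem_support_iff.1 hi0
  obtain ⟨h, hh⟩ := (C_dvd_iff_dvd_coeff D R).2 hdvd'
  refine ⟨S, h, (g * S) /ₘ f, D, by rw [← hh, ← hgS], hSunit, ?_⟩
  -- Otherwise h(a) = m e1 and f(a) = m e2 with m a nonunit. Writing f = m e2 + (X - a) p and h = m
  -- e1 + (X - a) h' gives h p = m (e1 p - e2 h') + f h'. As p(a) = f'(a) is a unit, S p is an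
  -- admissible multiplier whose remainder is divisible by D m, against maximality.
  by_contra hu
  obtain ⟨p, hp⟩ := X_sub_C_dvd_sub_C_eval (p := f) (a := a)
  obtain ⟨h', hh'⟩ := X_sub_C_dvd_sub_C_eval (p := h) (a := a)
  have hpa : f.derivative.eval a = p.eval a := by
    have := congrArg (fun r => (derivative r).eval a) hp
    simpa [derivative_mul] using this
  obtain ⟨m, hm, e1, e2, he1, he2⟩ : ∃ m, ¬ IsUnit m ∧ ∃ e1 e2,
      h.eval a = m * e1 ∧ f.eval a = m * e2 := by
    rcases ValuationRing.dvd_total (h.eval a) (f.eval a) with ⟨c, hc⟩ | ⟨c, hc⟩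
    · exact ⟨_, hu, 1, c, (mul_one _).symm, hc⟩
    · exact ⟨_, h0, c, 1, hc, (mul_one _).symm⟩
  have key : g * (S * p) = Polynomial.C (D * m) * (Polynomial.C e1 * p - Polynomial.C e2 * h') +
      f * (Polynomial.C D * h' + (g * S) /ₘ f * p) := by
    have e3 : f = Polynomial.C m * Polynomial.C e2 + (X - Polynomial.C a) * p := by rw [← hp, ← C_mul, ← he2]; ring
    have e4 : h = Polynomial.C m * Polynomial.C e1 + (X - Polynomial.C a) * h' := by rw [← hh', ← C_mul, ← he1]; ring
    rw [Polynomial.C_mul]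
    linear_combination p * hgS + p * hh + Polynomial.C D * p * e4 - Polynomial.C D * h' * e3
  have := hmax' (S * p) (by
      rw [eval_mul, map_mul, ← hpa]
      exact mul_ne_zero hSu ((residue_ne_zero_iff_isUnit _).2 h1)) (D * m) (fun i => by
      rw [key, add_modByMonic, mul_comm f, mul_self_modByMonic hf, add_zero,
        ← smul_eq_C_mul, ← modByMonicHom_apply, map_smul, Polynomial.coeff_smul]
      exact dvd_mul_right _ _) i0
  rw [← hD] at this
  obtain ⟨c, hc⟩ := this
  refine hm (IsUnit.of_mul_eq_one c ?_)
  refine mul_left_cancel₀ hD0 ?_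
  rw [mul_one, ← mul_assoc, ← hc]

end ValuationRing

end ValuedField

/-! ### Henselian immediate extensions -/

namespace ValuedField

open Polynomial

variable {W Γ₀ : Type*} [Field W] [LinearOrderedCommGroupWithZero Γ₀] {v : Valuation W Γ₀}

theorem eval_mem_subfield {E : Subfield W} {f : W[X]} (hf : ∀ i, f.coeff i ∈ E) {x : W}
    (hx : x ∈ E) : f.eval x ∈ E := by
  rw [eval_eq_sum]
  exact sum_mem fun i _ => mul_mem (hf i) (pow_mem hx i)

theorem exists_map_subtype {E : Subfield W} {f : W[X]} (hf : ∀ i, f.coeff i ∈ E) :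
    ∃ F : E[X], F.map E.subtype = f := by
  have : f ∈ Polynomial.lifts E.subtype := by
    rw [Polynomial.lifts_iff_coeff_lifts]
    exact fun i => ⟨⟨f.coeff i, hf i⟩, rfl⟩
  obtain ⟨F, hF⟩ := this
  exact ⟨F, hF⟩

theorem exists_integral_scale {E : Subfield W} {g : W[X]} (hg : ∀ i, g.coeff i ∈ E) :
    ∃ e ∈ E, e ≠ 0 ∧ IsIntegralPoly v (Polynomial.C e * g) := by
  by_cases h0 : g = 0
  · exact ⟨1, one_mem _, one_ne_zero, fun i => by simp [h0]⟩
  obtain ⟨i, hi, hmax⟩ := Finset.exists_max_image g.support (fun i => v (g.coeff i))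
    (by simpa using h0)
  have hne : g.coeff i ≠ 0 := mem_support_iff.1 hi
  refine ⟨(g.coeff i)⁻¹, inv_mem (hg i), inv_ne_zero hne, fun j => ?_⟩
  rw [coeff_C_mul, map_mul, map_inv₀]
  by_cases hj : j ∈ g.support
  · exact inv_mul_le_one_of_le₀ (hmax j hj) zero_le
  · simp [notMem_support_iff.1 hj]

/-- Over a valued field `E`, modulo a monic integral polynomial `f` with a simple residual
root `a`, every polynomial is a constant times a quotient of two polynomials that do not vanish
residually at `a`. -/
theorem exists_unit_factorization_subfield {E : Subfield W} {f : W[X]} (hf : f.Monic)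
    (hfE : ∀ i, f.coeff i ∈ E) (hfi : IsIntegralPoly v f) {a : W} (haE : a ∈ E) (ha : v a ≤ 1)
    (h0 : v (f.eval a) < 1) (h1 : v (f.derivative.eval a) = 1) {g : W[X]}
    (hg : ∀ i, g.coeff i ∈ E) :
    ∃ (s h q : W[X]) (d : W), (∀ i, s.coeff i ∈ E) ∧ (∀ i, h.coeff i ∈ E) ∧
      (∀ i, q.coeff i ∈ E) ∧ d ∈ E ∧ IsIntegralPoly v s ∧ IsIntegralPoly v h ∧
      g * s = Polynomial.C d * h + f * q ∧ v (s.eval a) = 1 ∧ v (h.eval a) = 1 := by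
  let A : ValuationSubring E := (v.comap E.subtype).valuationSubring
  let φ : A →+* W := E.subtype.comp A.subtype
  have hφE : ∀ x, φ x ∈ E := fun x => x.1.2
  have hφv : ∀ x, v (φ x) ≤ 1 := fun x => x.2
  have hmE : ∀ (P : A[X]) i, (P.map φ).coeff i ∈ E := fun P i => by
    rw [Polynomial.coeff_map]; exact hφE _
  have hmi : ∀ P : A[X], IsIntegralPoly v (P.map φ) := fun P i => by
    rw [Polynomial.coeff_map]; exact hφv _
  have hlift : ∀ p : W[X], (∀ i, p.coeff i ∈ E) → IsIntegralPoly v p →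
      ∃ P : A[X], P.map φ = p := by
    intro p hpE hpi
    have : p ∈ Polynomial.lifts φ := by
      rw [Polynomial.lifts_iff_coeff_lifts]
      exact fun i => ⟨⟨⟨p.coeff i, hpE i⟩, hpi i⟩, rfl⟩
    obtain ⟨F, hF⟩ := this
    exact ⟨F, hF⟩
  have hunit : ∀ x : A, IsUnit x ↔ v (φ x) = 1 := fun x =>
    Valuation.Integers.isUnit_iff_valuation_eq_one
      (Valuation.valuationSubring.integers (v.comap E.subtype))
  have hφinj : Function.Injective φ := E.subtype.injective.comp Subtype.val_injective
  obtain ⟨e, heE, he0, hei⟩ := exists_integral_scale (v := v) hg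
  obtain ⟨G, hG⟩ := hlift _ (fun i => by
    rw [coeff_C_mul]; exact mul_mem heE (hg i)) hei
  obtain ⟨F, rfl⟩ := hlift f hfE hfi
  obtain ⟨a, rfl⟩ : ∃ a', φ a' = a := ⟨⟨⟨a, haE⟩, ha⟩, rfl⟩
  rw [Polynomial.eval_map_apply] at h0
  rw [Polynomial.derivative_map, Polynomial.eval_map_apply] at h1
  obtain ⟨s, h, q, d, hgs, hs, hh⟩ := exists_unit_factorization
    (monic_of_injective hφinj hf) (a := a)
    ((IsLocalRing.mem_maximalIdeal _).2 fun hu => h0.ne ((hunit _).1 hu)) ((hunit _).2 h1) G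
  refine ⟨s.map φ, h.map φ, Polynomial.C e⁻¹ * q.map φ, e⁻¹ * φ d, hmE s, hmE h, fun i => ?_,
    mul_mem (inv_mem heE) (hφE d), hmi s, hmi h, ?_, ?_, ?_⟩
  · rw [coeff_C_mul]
    exact mul_mem (inv_mem heE) (hmE q i)
  · have h2 := congrArg (Polynomial.map φ) hgs
    simp only [Polynomial.map_mul, Polynomial.map_add, Polynomial.map_C, hG] at h2
    have h3 : Polynomial.C e⁻¹ * Polynomial.C e = (1 : W[X]) := by
      rw [← Polynomial.C_mul, inv_mul_cancel₀ he0, Polynomial.C_1]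
    rw [Polynomial.C_mul]
    linear_combination Polynomial.C e⁻¹ * h2 - g * s.map φ * h3
  · rw [Polynomial.eval_map_apply]; exact (hunit _).1 hs
  · rw [Polynomial.eval_map_apply]; exact (hunit _).1 hh

/-- Elements of a simple algebraic extension are values of polynomials. -/
theorem exists_poly_of_mem_adjoin {E : Subfield W} {x y : W} (hx : IsIntegral E x)
    (hy : y ∈ IntermediateField.adjoin E {x}) :
    ∃ g : W[X], (∀ i, g.coeff i ∈ E) ∧ g.eval x = y := by
  rw [← IntermediateField.mem_toSubalgebra,
    IntermediateField.adjoin_simple_toSubalgebra_of_isAlgebraic hx.isAlgebraic,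
    Algebra.adjoin_singleton_eq_range_aeval] at hy
  obtain ⟨p, rfl⟩ := hy
  refine ⟨p.map (algebraMap E W), fun i => ?_, ?_⟩
  · rw [Polynomial.coeff_map]; exact (p.coeff i).2
  · simp [Polynomial.eval_map_algebraMap]

/-- Adjoining a Hensel lift of a simple residual root is an immediate extension. -/
theorem immediate_adjoin_root {E : Subfield W} {f : W[X]} (hf : f.Monic)
    (hfE : ∀ i, f.coeff i ∈ E) (hfi : IsIntegralPoly v f) {a : W} (haE : a ∈ E) (ha : v a ≤ 1)
    (h0 : v (f.eval a) < 1) (h1 : v (f.derivative.eval a) = 1) {x : W} (hx : f.eval x = 0)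
    (hxa : v (x - a) < 1) : Immediate v E (IntermediateField.adjoin E {x}).toSubfield := by
  intro y hy
  have hint : IsIntegral E x := by
    obtain ⟨F, rfl⟩ := exists_map_subtype hfE
    refine ⟨F, monic_of_injective E.subtype.injective hf, ?_⟩
    rw [Polynomial.eval_map] at hx
    exact hx
  obtain ⟨g, hg, rfl⟩ := exists_poly_of_mem_adjoin hint hy
  obtain ⟨s, h, q, d, hsE, hhE, hqE, hd, hsi, hhi, e, hs, hh⟩ :=
    exists_unit_factorization_subfield hf hfE hfi haE ha h0 h1 hg
  have hs1 := hsi.eval_eq_one ha hxa hs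
  have hsx : s.eval x ≠ 0 := fun h => by simp [h] at hs1
  -- At x the multiple of f disappears, so g(x) = d h(x)/s(x). Since h and s have unit values at a
  -- and x is residually a, replacing x by a keeps leading terms. Irreducibility of f plays no role.
  have e' := congrArg (Polynomial.eval x) e
  simp only [eval_mul, eval_add, eval_C, hx, zero_mul, add_zero] at e'
  have hlead : ∀ p : W[X], IsIntegralPoly v p → v (p.eval a) = 1 →
      LeadEq v (p.eval x) (p.eval a) := fun p hp h1 =>
    leadEq_of_sub_lt_one (hp.eval_eq_one ha hxa h1)
      ((hp.eval_sub_le (le_one_of_sub_lt ha hxa) ha).trans_lt hxa)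
  refine ⟨d * h.eval a / s.eval a, div_mem (mul_mem hd (eval_mem_subfield hhE haE))
    (eval_mem_subfield hsE haE), ?_⟩
  rw [eq_div_of_mul_eq hsx e']
  exact ((LeadEq.refl d).mul (hlead h hhi hh)).div (hlead s hsi hs)

/-- Inside a henselian field, every subfield has a henselian immediate extension. -/
theorem exists_hensel_immediate {F T : Subfield W} (hT : Hensel v T) (hFT : F ≤ T) :
    ∃ E, F ≤ E ∧ E ≤ T ∧ Hensel v E ∧ Immediate v F E := by
  -- Take a maximal immediate extension inside T; a Hensel lift missing from it would generate a
  -- larger one.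
  obtain ⟨E, hFE, ⟨⟨_, hET, hE⟩, hmax⟩⟩ := zorn_le_nonempty₀
    {E : Subfield W | F ≤ E ∧ E ≤ T ∧ Immediate v F E} (by
      intro c hc hchain y hy
      refine ⟨sSup c, ⟨(hc hy).1.trans (le_sSup hy), sSup_le fun E hE => (hc hE).2.1, ?_⟩,
        fun E hE => le_sSup hE⟩
      intro x hx
      rw [Subfield.mem_sSup_of_directedOn ⟨y, hy⟩ hchain.directedOn] at hx
      obtain ⟨E, hE, hxE⟩ := hx
      exact (hc hE).2.2 x hxE) F ⟨le_rfl, hFT, fun y hy => ⟨y, hy, .refl y⟩⟩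
  refine ⟨E, hFE, hET, ?_, hE⟩
  intro f hf hfE hfi a haE ha h0 h1
  obtain ⟨x, hxT, hx, hxa⟩ := hT f hf (fun i => hET (hfE i)) hfi a (hET haE) ha h0 h1
  refine ⟨x, ?_, hx, hxa⟩
  have hEx : E ≤ (IntermediateField.adjoin E {x}).toSubfield := fun y hy =>
    (IntermediateField.adjoin E {x}).algebraMap_mem ⟨y, hy⟩
  refine hmax ⟨hFE.trans hEx, ?_, hE.trans (immediate_adjoin_root hf hfE hfi haE ha h0 h1 hx hxa)⟩
    hEx (IntermediateField.mem_adjoin_simple_self E x)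
  have hint : IsIntegral E x := by
    obtain ⟨F, rfl⟩ := exists_map_subtype hfE
    refine ⟨F, monic_of_injective E.subtype.injective hf, ?_⟩
    rw [Polynomial.eval_map] at hx
    exact hx
  intro y hy
  obtain ⟨g, hg, rfl⟩ := exists_poly_of_mem_adjoin hint hy
  exact eval_mem_subfield (fun i => hET (hg i)) hxT

end ValuedField

/-! ### The power series field is henselian, and henselizations are immediate -/

namespace PowerSeriesField

open Polynomial

open ValuedField

variable {k G : Type*} [Field k] [AddCommGroup G] [LinearOrder G] [IsOrderedAddMonoid G]

variable (k G) in
/-- The canonical valuation of `k((G))`, written multiplicatively. -/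
noncomputable def hahnVal : Valuation (HahnSeries G k) (Multiplicative (WithTop G)ᵒᵈ) :=
  AddValuation.toValuation (addVal G k)

theorem hahnVal_le {x y : HahnSeries G k} :
    hahnVal k G x ≤ hahnVal k G y ↔ y.orderTop ≤ x.orderTop := Iff.rfl

theorem hahnVal_lt {x y : HahnSeries G k} :
    hahnVal k G x < hahnVal k G y ↔ y.orderTop < x.orderTop := Iff.rfl

theorem hahnVal_eq {x y : HahnSeries G k} :
    hahnVal k G x = hahnVal k G y ↔ y.orderTop = x.orderTop := by
  rw [le_antisymm_iff, hahnVal_le, hahnVal_le, ← le_antisymm_iff]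

theorem hahnVal_le_one {x : HahnSeries G k} : hahnVal k G x ≤ 1 ↔ 0 ≤ x.orderTop := by
  rw [← map_one (hahnVal k G), hahnVal_le, orderTop_one]

theorem hahnVal_lt_one {x : HahnSeries G k} : hahnVal k G x < 1 ↔ 0 < x.orderTop := by
  rw [← map_one (hahnVal k G), hahnVal_lt, orderTop_one]

omit [AddCommGroup G] [IsOrderedAddMonoid G] in
/-- Spherical completeness of `k((G))`. -/
theorem exists_pseudo_limit (c : Set (HahnSeries G k)) (ρ : HahnSeries G k → WithTop G)
    (h : ∀ x ∈ c, ∀ y ∈ c, ρ x ≤ ρ y → ρ x ≤ (x - y).orderTop) :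
    ∃ y : HahnSeries G k, ∀ x ∈ c, ρ x ≤ (y - x).orderTop := by
  classical
  have hcoeff : ∀ x ∈ c, ∀ y ∈ c, ∀ g : G, (g : WithTop G) < ρ x → (g : WithTop G) < ρ y →
      x.coeff g = y.coeff g := by
    have key : ∀ x ∈ c, ∀ y ∈ c, ∀ g : G, (g : WithTop G) < ρ x → ρ x ≤ ρ y →
        x.coeff g = y.coeff g := by
      intro x hx y hy g hg hxy
      have := coeff_eq_zero_of_lt_orderTop (hg.trans_le (h x hx y hy hxy))
      rwa [HahnSeries.coeff_sub, sub_eq_zero] at this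
    intro x hx y hy g h1 h2
    rcases le_total (ρ x) (ρ y) with h3 | h3
    · exact key x hx y hy g h1 h3
    · exact (key y hy x hx g h2 h3).symm
  -- ρ x is the radius of a ball around x. The balls are nested, so the coefficient at g is the same
  -- for all centres x with g < ρ x.
  let F : G → k := fun g => if H : ∃ x ∈ c, (g : WithTop G) < ρ x then H.choose.coeff g else 0
  have hF : ∀ x ∈ c, ∀ g : G, (g : WithTop G) < ρ x → F g = x.coeff g := by
    intro x hx g hg
    have H : ∃ x ∈ c, (g : WithTop G) < ρ x := ⟨x, hx, hg⟩
    simp only [F, dif_pos H]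
    exact hcoeff _ H.choose_spec.1 _ hx g H.choose_spec.2 hg
  have hWF : (Function.support F).IsWF := by
    rw [Set.isWF_iff_no_descending_seq]
    intro s hs hsupp
    obtain ⟨x, hx, hx0⟩ : ∃ x ∈ c, (s 0 : WithTop G) < ρ x := by
      by_contra H
      exact hsupp 0 (dif_neg H)
    -- At and below s 0 the function F agrees with the single series x, so a descending sequence
    -- would lie in the support of x.
    refine Set.isWF_iff_no_descending_seq.1 x.isWF_support s hs fun n => ?_
    rw [mem_support, ← hF x hx (s n)]
    · exact hsupp n
    · exact (WithTop.coe_le_coe.2 (hs.antitone (Nat.zero_le n))).trans_lt hx0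
  refine ⟨⟨F, hWF.isPWO⟩, fun x hx => le_orderTop_iff_forall.2 fun g hg => ?_⟩
  rw [HahnSeries.coeff_sub, sub_eq_zero]
  exact hF x hx g hg

/-- The field `k((G))` is henselian. -/
theorem hensel_hahnVal_top : Hensel (hahnVal k G) ⊤ := by
  intro f hf _ hfi a _ ha h0 h1
  set v := hahnVal k G with hv
  let S := {x : HahnSeries G k // v (x - a) < 1}
  -- Approximations are ordered by improvement: y lies within the error f(x) of x and has no larger
  -- error. Pseudo-limits bound chains, so a maximal approximation exists.
  let r : S → S → Prop := fun x y =>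
    v (x.1 - y.1) ≤ v (f.eval x.1) ∧ v (f.eval y.1) ≤ v (f.eval x.1)
  have hS : ∀ x : S, v x.1 ≤ 1 := fun x => le_one_of_sub_lt ha x.2
  have hSf : ∀ x : S, v (f.eval x.1) < 1 := fun x => hfi.eval_lt_one ha x.2 h0
  obtain ⟨m, hm⟩ := exists_maximal_of_chains_bounded (r := r) (by
    intro c hc
    rcases c.eq_empty_or_nonempty with rfl | ⟨x0, hx0⟩
    · exact ⟨⟨a, by simp⟩, by simp⟩
    obtain ⟨y, hy⟩ := exists_pseudo_limit (Subtype.val '' c) (fun x => (f.eval x).orderTop) (by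
      rintro _ ⟨x, hx, rfl⟩ _ ⟨y, hy, rfl⟩ hxy
      by_cases hne : x = y
      · simp [hne]
      rcases hc hx hy hne with h | h
      · exact h.1
      · rw [← hahnVal_le]
        have h2 := h.1
        rw [Valuation.map_sub_swap] at h2
        exact h2.trans hxy)
    have hy' : ∀ x ∈ c, v (y - x.1) ≤ v (f.eval x.1) := fun x hx => hy _ ⟨x, hx, rfl⟩
    have hyS : v (y - a) < 1 := by
      rw [← sub_add_sub_cancel y x0.1 a]
      exact Valuation.map_add_lt v ((hy' x0 hx0).trans_lt (hSf x0)) x0.2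
    refine ⟨⟨y, hyS⟩, fun x hx => ⟨?_, ?_⟩⟩
    · rw [Valuation.map_sub_swap]; exact hy' x hx
    · rw [← sub_add_cancel (f.eval y) (f.eval x.1)]
      exact Valuation.map_add_le v ((hfi.eval_sub_le (hS ⟨y, hyS⟩) (hS x)).trans (hy' x hx)) le_rfl)
    (by
      intro x y z h h'
      refine ⟨?_, h'.2.trans h.2⟩
      rw [← sub_add_sub_cancel x.1 y.1 z.1]
      exact Valuation.map_add_le v h.1 (h'.1.trans h.2))
  refine ⟨m.1, trivial, ?_, m.2⟩
  by_contra hfm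
  have hd : v (f.derivative.eval m.1) = 1 := hfi.derivative.eval_eq_one ha m.2 h1
  have hd0 : f.derivative.eval m.1 ≠ 0 := fun h => by simp [h] at hd
  -- A Newton step cancels the linear Taylor term, so v(f(y)) ≤ v(f(m))² < v(f(m)), contradicting
  -- maximality of m.
  set y := m.1 - f.eval m.1 / f.derivative.eval m.1 with hy
  have hym : y - m.1 = -(f.eval m.1 / f.derivative.eval m.1) := by rw [hy]; ring
  have hvym : v (y - m.1) = v (f.eval m.1) := by
    rw [hym, Valuation.map_neg, map_div₀, hd, div_one]
  have hyS : v (y - a) < 1 := by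
    rw [← sub_add_sub_cancel y m.1 a]
    exact Valuation.map_add_lt v (hvym ▸ hSf m) m.2
  obtain ⟨e, he, ht⟩ := hfi.exists_taylor (hS ⟨y, hyS⟩) (hS m)
  have hlt : v (f.eval y) < v (f.eval m.1) := by
    have : f.eval y = (e * (y - m.1)) * (y - m.1) := by
      rw [ht]
      have : f.derivative.eval m.1 * (y - m.1) = - f.eval m.1 := by
        rw [hym]; field_simp
      rw [this]; ring
    rw [this, map_mul _ _ (y - m.1), hvym, map_mul, hvym]
    have hpos : 0 < v (f.eval m.1) := by
      rw [zero_lt_iff]; simpa using hfm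
    calc v e * v (f.eval m.1) * v (f.eval m.1)
        ≤ v (f.eval m.1) * v (f.eval m.1) := by
          gcongr
          exact mul_le_of_le_one_left' he
      _ < 1 * v (f.eval m.1) := mul_lt_mul_of_pos_right (hSf m) hpos
      _ = _ := one_mul _
  have := hm ⟨y, hyS⟩ ⟨by rw [Valuation.map_sub_swap]; exact hvym.le, hlt.le⟩
  exact absurd this.2 (not_le.2 hlt)

theorem isUnit_valuationRing_iff {F : Subfield (HahnSeries G k)} {x : valuationRing F} :
    IsUnit x ↔ hahnVal k G x.1 = 1 := by
  constructor
  · rintro ⟨u, rfl⟩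
    have h1 : hahnVal k G u.1.1 ≤ 1 := hahnVal_le_one.2 u.1.2.2
    have h2 : hahnVal k G (u⁻¹).1.1 ≤ 1 := hahnVal_le_one.2 (u⁻¹).1.2.2
    have h3 : u.1.1 * (u⁻¹).1.1 = 1 := congrArg Subtype.val u.mul_inv
    have h4 := congrArg (hahnVal k G) h3
    rw [map_mul, map_one] at h4
    refine le_antisymm h1 (h4 ▸ mul_le_of_le_one_right' h2)
  · intro h
    have h0 : x.1 ≠ 0 := fun h0 => by simp [h0] at h
    refine IsUnit.of_mul_eq_one ⟨x.1⁻¹, F.inv_mem x.2.1, ?_⟩ (Subtype.ext ?_)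
    · refine hahnVal_le_one.1 ?_
      rw [map_inv₀, h, inv_one]
    · exact mul_inv_cancel₀ h0

/-- Nonunits of the valuation ring are exactly the elements of value below 1, so this ring is local
and both conditions concern the same lifts of simple residual roots. -/
theorem isHenselian_iff {F : Subfield (HahnSeries G k)} :
    IsHenselian F ↔ Hensel (hahnVal k G) F := by
  have hle : ∀ x : valuationRing F, hahnVal k G x.1 ≤ 1 := fun x => hahnVal_le_one.2 x.2.2
  have hnon : ∀ x : valuationRing F, ¬ IsUnit x ↔ hahnVal k G x.1 < 1 := fun x => by
    rw [isUnit_valuationRing_iff, lt_iff_le_and_ne]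
    exact ⟨fun h => ⟨hle x, h⟩, fun h => h.2⟩
  let φ : valuationRing F →+* HahnSeries G k := (valuationRing F).subtype
  have hφ : ∀ x, φ x = x.1 := fun _ => rfl
  constructor
  · intro h f hf hfF hfi a haF ha h0 h1
    obtain ⟨P, rfl⟩ : ∃ P : (valuationRing F)[X], P.map φ = f := by
      have : f ∈ Polynomial.lifts φ := by
        rw [Polynomial.lifts_iff_coeff_lifts]
        exact fun i => ⟨⟨f.coeff i, hfF i, hahnVal_le_one.1 (hfi i)⟩, rfl⟩
      obtain ⟨P, hP⟩ := this
      exact ⟨P, hP⟩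
    obtain ⟨b, rfl⟩ : ∃ b, φ b = a := ⟨⟨a, haF, hahnVal_le_one.1 ha⟩, rfl⟩
    rw [Polynomial.eval_map_apply] at h0
    rw [Polynomial.derivative_map, Polynomial.eval_map_apply] at h1
    have : HenselianLocalRing (valuationRing F) := h
    have : IsLocalRing (valuationRing F) := this.toIsLocalRing
    obtain ⟨x, hx, hxb⟩ := HenselianLocalRing.is_henselian P
      (monic_of_injective Subtype.val_injective hf) b
      ((IsLocalRing.mem_maximalIdeal _).2 ((hnon _).2 h0)) (isUnit_valuationRing_iff.2 h1)
    refine ⟨φ x, x.2.1, ?_, (hnon _).1 ((IsLocalRing.mem_maximalIdeal _).1 hxb)⟩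
    rw [Polynomial.eval_map_apply, hx.eq_zero, map_zero]
  · intro h
    have hloc : IsLocalRing (valuationRing F) := .of_nonunits_add fun x y hx hy => by
      rw [mem_nonunits_iff, hnon] at *
      exact Valuation.map_add_lt _ hx hy
    refine @HenselianLocalRing.mk _ _ hloc fun P hP a h0 h1 => ?_
    rw [IsLocalRing.mem_maximalIdeal, mem_nonunits_iff, hnon] at h0
    rw [isUnit_valuationRing_iff] at h1
    obtain ⟨x, hxF, hx, hxa⟩ := h (P.map φ) (hP.map φ)
      (fun i => by rw [Polynomial.coeff_map]; exact (P.coeff i).2.1)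
      (fun i => by rw [Polynomial.coeff_map]; exact hle _) a.1 a.2.1 (hle a)
      (by rw [← hφ, Polynomial.eval_map_apply]; exact h0)
      (by rw [← hφ, Polynomial.derivative_map, Polynomial.eval_map_apply]; exact h1)
    obtain ⟨x, rfl⟩ : ∃ b, φ b = x :=
      ⟨⟨x, hxF, hahnVal_le_one.1 (le_one_of_sub_lt (hle a) hxa)⟩, rfl⟩
    rw [Polynomial.eval_map_apply] at hx
    refine ⟨x, Subtype.ext hx, ?_⟩
    rw [IsLocalRing.mem_maximalIdeal, mem_nonunits_iff, hnon]
    exact hxa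

theorem LeadEq.orderTop_eq {x y : HahnSeries G k} (h : LeadEq (hahnVal k G) x y) :
    x.orderTop = y.orderTop :=
  (hahnVal_eq.1 h.map_eq).symm

theorem LeadEq.order_eq {x y : HahnSeries G k} (h : LeadEq (hahnVal k G) x y) :
    x.order = y.order := by
  by_cases hx : x = 0
  · rw [hx, h.eq_zero_iff.1 hx]
  have hy : y ≠ 0 := fun hy => hx (h.eq_zero_iff.2 hy)
  have := LeadEq.orderTop_eq h
  rwa [← order_eq_orderTop_of_ne_zero hx, ← order_eq_orderTop_of_ne_zero hy,
    WithTop.coe_inj] at this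

omit [AddCommGroup G] [IsOrderedAddMonoid G] in
theorem coeff_eq_of_sub {x y : HahnSeries G k} {g : G} (h : (g : WithTop G) < (x - y).orderTop) :
    x.coeff g = y.coeff g := by
  have := coeff_eq_zero_of_lt_orderTop h
  rwa [HahnSeries.coeff_sub, sub_eq_zero] at this

theorem valueGroup_le_of_immediate {F E : Subfield (HahnSeries G k)}
    (h : Immediate (hahnVal k G) F E) : valueGroup E ≤ valueGroup F := by
  rintro _ ⟨x, hx, hx0, rfl⟩
  obtain ⟨d, hd, hxd⟩ := h x hx
  exact ⟨d, hd, fun h => hx0 (hxd.eq_zero_iff.2 h), (LeadEq.order_eq hxd).symm⟩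

theorem residueField_le_of_immediate {F E : Subfield (HahnSeries G k)}
    (h : Immediate (hahnVal k G) F E) : residueField E ≤ residueField F := by
  rintro _ ⟨x, hx, rfl⟩
  obtain ⟨d, hd, hxd⟩ := h x hx.1
  refine ⟨d, ⟨hd, hahnVal_le_one.1 (hxd.map_eq ▸ hahnVal_le_one.2 hx.2)⟩, ?_⟩
  exact (coeff_eq_of_sub (hahnVal_lt_one.1 (hxd.sub_lt_one (hahnVal_le_one.2 hx.2)))).symm

/-- Immediacy passes to subextensions, so it suffices that some henselian immediate extension of F
exists in k((G)); the smallest henselian field lies inside it. -/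
theorem immediate_henselization (F : Subfield (HahnSeries G k)) :
    Immediate (hahnVal k G) F (henselization F) := by
  obtain ⟨E, hFE, -, hE, him⟩ := exists_hensel_immediate hensel_hahnVal_top (le_top : F ≤ ⊤)
  intro y hy
  have : henselization F ≤ E := sInf_le ⟨hFE, isHenselian_iff.2 hE⟩
  exact him y (this hy)

end PowerSeriesField

/-! ### Extending a specialization of z to a henselian field -/

namespace ValuedField

open Polynomial

open Filter

variable {W Γ₀ : Type*} [Field W] [LinearOrderedCommGroupWithZero Γ₀] {v : Valuation W Γ₀}

variable (v) in
/-- A ring of pairs consisting of an element of `W` and a sequence in `L` whose terms eventually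
have the same leading term as the element. -/
def IsSpecialization (L : Subfield W) (R : Subring (W × (ℕ → W))) : Prop :=
  ∀ ρ ∈ R, (∀ n, ρ.2 n ∈ L) ∧ ∀ᶠ n in atTop, LeadEq v ρ.1 (ρ.2 n)

/-- The first component. -/
def limitHom (R : Subring (W × (ℕ → W))) : R →+* W := (RingHom.fst W (ℕ → W)).comp R.subtype

/-- The terms of the second component. -/
def termHom (R : Subring (W × (ℕ → W))) (n : ℕ) : R →+* W :=
  ((Pi.evalRingHom (fun _ => W) n).comp (RingHom.snd W (ℕ → W))).comp R.subtype

namespace IsSpecialization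

variable {L : Subfield W} {R : Subring (W × (ℕ → W))}

theorem eventually (hR : IsSpecialization v L R) (ρ : R) :
    ∀ᶠ n in atTop, LeadEq v (limitHom R ρ) (termHom R n ρ) := (hR ρ.1 ρ.2).2

theorem termHom_mem (hR : IsSpecialization v L R) (ρ : R) (n : ℕ) : termHom R n ρ ∈ L :=
  (hR ρ.1 ρ.2).1 n

theorem eventually_coeff (hR : IsSpecialization v L R) (P : R[X]) :
    ∀ᶠ n in atTop, ∀ i, LeadEq v ((P.map (limitHom R)).coeff i) ((P.map (termHom R n)).coeff i) := by
  have : ∀ᶠ n in atTop, ∀ i ∈ P.support,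
      LeadEq v (limitHom R (P.coeff i)) (termHom R n (P.coeff i)) :=
    (eventually_all_finset _).2 fun i _ => hR.eventually _
  filter_upwards [this] with n hn i
  rw [Polynomial.coeff_map, Polynomial.coeff_map]
  by_cases hi : i ∈ P.support
  · exact hn i hi
  · rw [notMem_support_iff.1 hi, map_zero, map_zero]
    exact .refl _

theorem eventually_eval (hR : IsSpecialization v L R) (P : R[X]) (ρ : R) :
    ∀ᶠ n in atTop, LeadEq v ((P.map (limitHom R)).eval (limitHom R ρ))
      ((P.map (termHom R n)).eval (termHom R n ρ)) := by
  simp_rw [Polynomial.eval_map_apply]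
  exact hR.eventually _

theorem eventually_integral (hR : IsSpecialization v L R) (P : R[X])
    (hP : IsIntegralPoly v (P.map (limitHom R))) :
    ∀ᶠ n in atTop, IsIntegralPoly v (P.map (termHom R n)) := by
  filter_upwards [hR.eventually_coeff P] with n hn i
  rw [← (hn i).map_eq]
  exact hP i

theorem eventually_eq_zero (hR : IsSpecialization v L R) (P : R[X])
    (hP : P.map (limitHom R) = 0) : ∀ᶠ n in atTop, P.map (termHom R n) = 0 := by
  filter_upwards [hR.eventually_coeff P] with n hn
  ext i
  have := hn i
  rw [hP, Polynomial.coeff_zero, leadEq_zero_left] at this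
  rw [this, Polynomial.coeff_zero]

/-- The hypothesis says that the ring generated by R and the pair (x, s) is still a specialization,
so maximality absorbs the pair. -/
theorem mem_of_maximal (hR : Maximal (IsSpecialization v L) R) {x : W} {s : ℕ → W}
    (hs : ∀ n, s n ∈ L) (h : ∀ P : R[X], ∀ᶠ n in atTop,
      LeadEq v ((P.map (limitHom R)).eval x) ((P.map (termHom R n)).eval (s n))) :
    (x, s) ∈ R := by
  let φ : R[X] →+* W × (ℕ → W) := eval₂RingHom R.subtype (x, s)
  have hφ1 : ∀ P, (φ P).1 = (P.map (limitHom R)).eval x := fun P => by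
    rw [eval_map]
    exact hom_eval₂ P R.subtype (RingHom.fst W (ℕ → W)) (x, s)
  have hφ2 : ∀ P n, (φ P).2 n = (P.map (termHom R n)).eval (s n) := fun P n => by
    rw [eval_map]
    exact hom_eval₂ P R.subtype ((Pi.evalRingHom (fun _ => W) n).comp (RingHom.snd W (ℕ → W)))
      (x, s)
  have hle : R ≤ φ.range := fun ρ hρ => ⟨Polynomial.C ⟨ρ, hρ⟩, by simp [φ]⟩
  refine hR.2 ?_ hle ⟨X, by simp [φ]⟩
  rintro _ ⟨P, rfl⟩
  refine ⟨fun n => ?_, ?_⟩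
  · rw [hφ2]
    refine eval_mem_subfield (fun i => ?_) (hs n)
    rw [Polynomial.coeff_map]
    exact hR.1.termHom_mem _ _
  · simp_rw [hφ1, hφ2]
    exact h P

/-- A polynomial at an inverse is the reversed polynomial at the element times a power of the
inverse, so the pair of inverses passes the test of `mem_of_maximal`. -/
theorem exists_inv (hR : Maximal (IsSpecialization v L) R) (ρ : R) :
    ∃ σ, limitHom R σ = (limitHom R ρ)⁻¹ := by
  by_cases h0 : limitHom R ρ = 0
  · exact ⟨0, by rw [h0, map_zero, inv_zero]⟩
  refine ⟨⟨((limitHom R ρ)⁻¹, fun n => (termHom R n ρ)⁻¹), mem_of_maximal hR (fun n =>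
    inv_mem (hR.1.termHom_mem _ _)) fun P => ?_⟩, rfl⟩
  have key : ∀ (i : R →+* W), i ρ ≠ 0 →
      (P.map i).eval (i ρ)⁻¹ = (P.reverse.map i).eval (i ρ) * ((i ρ)⁻¹) ^ P.natDegree := by
    intro i hi
    let := invertibleOfNonzero (inv_ne_zero hi)
    rw [eval_map, eval_map, ← eval₂_reverse_mul_pow i, invOf_eq_inv, inv_inv]
  filter_upwards [hR.1.eventually ρ, hR.1.eventually_eval P.reverse ρ] with n h1 h2
  rw [key _ h0, key _ (fun h => h0 (h1.eq_zero_iff.2 h))]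
  exact h2.mul (h1.inv.pow _)

/-- The first components of a maximal specialization form a field. -/
def limitField (hR : Maximal (IsSpecialization v L) R) : Subfield W :=
  { (limitHom R).range with
    inv_mem' := by
      rintro _ ⟨ρ, rfl⟩
      exact exists_inv hR ρ }

/-- The root x is paired with the Hensel lifts s n in L of the termwise polynomials, whose data
eventually have the same leading terms. The unit factorization writes any P at x as D H/S with H and
S residually determined at the approximate root, and the same formula holds at s n for large n. -/
theorem hensel_limitField (hW : Hensel v ⊤) (hL : Hensel v L)
    (hR : Maximal (IsSpecialization v L) R) : Hensel v (limitField hR) := by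
  have hlift : ∀ p : W[X], (∀ i, p.coeff i ∈ limitField hR) → p ∈ lifts (limitHom R) :=
    fun p hp => (lifts_iff_coeff_lifts p).2 hp
  intro f hf hfE hfi a haE ha h0 h1
  obtain ⟨x, -, hx, hxa⟩ := hW f hf (fun _ => trivial) hfi a trivial ha h0 h1
  suffices hmem : ∃ s, (x, s) ∈ R by
    obtain ⟨s, hs⟩ := hmem
    exact ⟨x, ⟨⟨_, hs⟩, rfl⟩, hx, hxa⟩
  obtain ⟨F, rfl, -, hF⟩ := lifts_and_natDegree_eq_and_monic (hlift f hfE) hf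
  obtain ⟨α, rfl⟩ := haE
  rw [derivative_map] at h1
  have hroot : ∀ n, ∃ y ∈ L, IsIntegralPoly v (F.map (termHom R n)) → v (termHom R n α) ≤ 1 →
      v ((F.map (termHom R n)).eval (termHom R n α)) < 1 →
      v (((derivative F).map (termHom R n)).eval (termHom R n α)) = 1 →
      (F.map (termHom R n)).eval y = 0 ∧ v (y - termHom R n α) < 1 := by
    intro n
    by_cases h : IsIntegralPoly v (F.map (termHom R n)) ∧ v (termHom R n α) ≤ 1 ∧
      v ((F.map (termHom R n)).eval (termHom R n α)) < 1 ∧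
      v (((derivative F).map (termHom R n)).eval (termHom R n α)) = 1
    · obtain ⟨y, hy, h2⟩ := hL (F.map (termHom R n)) (hF.map _) (fun i => by
        rw [Polynomial.coeff_map]; exact hR.1.termHom_mem _ _) h.1 _ (hR.1.termHom_mem α n) h.2.1
        h.2.2.1 (by rw [derivative_map]; exact h.2.2.2)
      exact ⟨y, hy, fun _ _ _ _ => h2⟩
    -- An arbitrary value for the finitely many n at which the termwise data do not form a simple
    -- residual root.
    · exact ⟨0, zero_mem _, fun h2 h3 h4 h5 => absurd ⟨h2, h3, h4, h5⟩ h⟩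
  choose s hsL hs using hroot
  refine ⟨s, mem_of_maximal hR hsL fun P => ?_⟩
  obtain ⟨S, H, Q, d, hSE, hHE, hQE, hdE, hSi, hHi, e, hS1, hH1⟩ :=
    exists_unit_factorization_subfield hf hfE hfi (a := limitHom R α) ⟨α, rfl⟩ ha h0
      (by rw [derivative_map]; exact h1) (g := P.map (limitHom R)) (fun i => by
        rw [Polynomial.coeff_map]; exact ⟨_, rfl⟩)
  obtain ⟨S, rfl⟩ := hlift S hSE
  obtain ⟨H, rfl⟩ := hlift H hHE
  obtain ⟨Q, rfl⟩ := hlift Q hQE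
  obtain ⟨D, rfl⟩ := hdE
  rw [coe_mapRingHom] at *
  have hxe : ∀ p : R[X], IsIntegralPoly v (p.map (limitHom R)) →
      v ((p.map (limitHom R)).eval (limitHom R α)) = 1 →
      ∀ᶠ n in atTop, LeadEq v ((p.map (limitHom R)).eval x) ((p.map (termHom R n)).eval (s n)) := by
    intro p hpi hp1
    have e1 : LeadEq v ((p.map (limitHom R)).eval x) ((p.map (limitHom R)).eval (limitHom R α)) :=
      leadEq_of_sub_lt_one (hpi.eval_eq_one ha hxa hp1)
        ((hpi.eval_sub_le (le_one_of_sub_lt ha hxa) ha).trans_lt hxa)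
    filter_upwards [hR.1.eventually_integral F hfi, hR.1.eventually_integral p hpi,
      hR.1.eventually α, hR.1.eventually_eval F α, hR.1.eventually_eval (derivative F) α,
      hR.1.eventually_eval p α] with n h2 h3 h4 h5 h6 h7
    have ha' : v (termHom R n α) ≤ 1 := h4.map_eq ▸ ha
    have h8 := (hs n h2 ha' (h5.map_eq ▸ h0) (h6.map_eq ▸ h1)).2
    refine e1.trans (h7.trans (leadEq_of_sub_lt_one (h7.map_eq ▸ hp1) ?_))
    rw [Valuation.map_sub_swap]
    exact (h3.eval_sub_le (le_one_of_sub_lt ha' h8) ha').trans_lt h8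
  -- The factorization holds only for the first components; its lift to R vanishes there, hence also
  -- termwise for large n.
  have hzero := hR.1.eventually_eq_zero (P * S - (Polynomial.C D * H + F * Q)) (by
    simp only [Polynomial.map_sub, Polynomial.map_mul, Polynomial.map_add, Polynomial.map_C]
    rw [e, sub_self])
  have key : ∀ (i : R →+* W) (y : W), (F.map i).eval y = 0 → (S.map i).eval y ≠ 0 →
      (P * S - (Polynomial.C D * H + F * Q)).map i = 0 →
      (P.map i).eval y = i D * (H.map i).eval y / (S.map i).eval y := by
    intro i y hy hSy h
    have := congrArg (Polynomial.eval y) h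
    simp only [Polynomial.map_sub, Polynomial.map_mul, Polynomial.map_add, Polynomial.map_C,
      eval_sub, eval_mul, eval_add, eval_C, hy, zero_mul, add_zero, eval_zero, sub_eq_zero] at this
    exact eq_div_of_mul_eq hSy this
  have hSx : ((S.map (limitHom R)).eval x) ≠ 0 := fun h => by
    have := hSi.eval_eq_one ha hxa hS1
    rw [h, map_zero] at this
    exact zero_ne_one this
  filter_upwards [hzero, hxe S hSi hS1, hxe H hHi hH1, hR.1.eventually D,
    hR.1.eventually_integral F hfi, hR.1.eventually α, hR.1.eventually_eval F α,
    hR.1.eventually_eval (derivative F) α] with n h2 h3 h4 h5 h6 h7 h8 h9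
  have hsn := (hs n h6 (h7.map_eq ▸ ha) (h8.map_eq ▸ h0) (h9.map_eq ▸ h1)).1
  rw [key _ x hx hSx (by
    simp only [Polynomial.map_sub, Polynomial.map_mul, Polynomial.map_add, Polynomial.map_C]
    rw [e, sub_self]), key _ (s n) hsn (fun h => hSx (h3.eq_zero_iff.2 h)) h2]
  exact (h5.mul h4).div h3

end IsSpecialization

/-- If the leading terms of polynomials over a henselian field `L` at `z` are those at the terms
of a sequence in `L`, then `z` lies in a henselian immediate extension of `L` in which `L` is
relatively algebraically closed. -/
theorem exists_hensel_specialization (hW : Hensel v ⊤) {L : Subfield W} (hL : Hensel v L) {z : W}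
    {s : ℕ → W} (hs : ∀ n, s n ∈ L)
    (h : ∀ g : L[X], ∀ᶠ n in atTop,
      LeadEq v ((g.map L.subtype).eval z) ((g.map L.subtype).eval (s n))) :
    ∃ E, L ≤ E ∧ z ∈ E ∧ Hensel v E ∧ Immediate v L E ∧ ∀ a ∈ E, IsAlgebraic L a → a ∈ L := by
  let ι : L →+* W × (ℕ → W) := L.subtype.prod (RingHom.pi fun _ => L.subtype)
  let φ : L[X] →+* W × (ℕ → W) := eval₂RingHom ι (z, s)
  have hφ1 : ∀ P, (φ P).1 = (P.map L.subtype).eval z := fun P => by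
    rw [eval_map]
    exact hom_eval₂ P ι (RingHom.fst W (ℕ → W)) (z, s)
  have hφ2 : ∀ P n, (φ P).2 n = (P.map L.subtype).eval (s n) := fun P n => by
    rw [eval_map]
    exact hom_eval₂ P ι ((Pi.evalRingHom (fun _ => W) n).comp (RingHom.snd W (ℕ → W))) (z, s)
  have h0 : IsSpecialization v L φ.range := by
    rintro _ ⟨P, rfl⟩
    refine ⟨fun n => ?_, ?_⟩
    · rw [hφ2]
      exact eval_mem_subfield (fun i => by rw [Polynomial.coeff_map]; exact (P.coeff i).2) (hs n)
    · simp_rw [hφ1, hφ2]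
      exact h P
  obtain ⟨R, hφR, hR⟩ := zorn_le_nonempty₀ {R | IsSpecialization v L R} (by
    intro c hc hchain y hy
    refine ⟨sSup c, fun ρ hρ => ?_, fun R hR => le_sSup hR⟩
    rw [Subring.mem_sSup_of_directedOn ⟨y, hy⟩ hchain.directedOn] at hρ
    obtain ⟨R, hR, hρR⟩ := hρ
    exact hc hR ρ hρR) _ h0
  have hR : Maximal (IsSpecialization v L) R := hR
  have hι : ∀ c, ι c ∈ R := fun c => hφR ⟨Polynomial.C c, by simp [φ]⟩
  refine ⟨IsSpecialization.limitField hR, fun c hc => ⟨⟨_, hι ⟨c, hc⟩⟩, rfl⟩,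
    ⟨⟨(z, s), hφR ⟨X, by simp [φ]⟩⟩, rfl⟩, IsSpecialization.hensel_limitField hW hL hR, ?_, ?_⟩
  · rintro _ ⟨ρ, rfl⟩
    obtain ⟨n, hn⟩ := (hR.1.eventually ρ).exists
    exact ⟨_, hR.1.termHom_mem ρ n, hn⟩
  · rintro _ ⟨ρ, rfl⟩ halg
    -- The minimal polynomial vanishes at the limit, hence also at some term of the sequence. That
    -- term lies in L, so the irreducible polynomial is linear.
    let p := minpoly L (limitHom R ρ)
    let j : L →+* R := ι.codRestrict R hι
    obtain ⟨n, hn⟩ := (hR.1.eventually_eval (p.map j) ρ).exists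
    rw [Polynomial.map_map, Polynomial.map_map] at hn
    have h1 : (p.map ((limitHom R).comp j)).eval (limitHom R ρ) = 0 := by
      rw [eval_map]; exact minpoly.aeval L (limitHom R ρ)
    rw [h1, leadEq_zero_left] at hn
    have h2 : (p.map L.subtype).eval (termHom R n ρ) = 0 := hn
    have h3 : IsRoot p ⟨termHom R n ρ, hR.1.termHom_mem ρ n⟩ := by
      refine L.subtype.injective ?_
      rw [← Polynomial.eval_map_apply, map_zero]
      exact h2
    have h4 := degree_eq_one_of_irreducible_of_root (minpoly.irreducible halg.isIntegral) h3
    obtain ⟨c, hc⟩ := minpoly.degree_eq_one_iff.1 h4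
    exact hc ▸ c.2

end ValuedField

/-! ### Uniqueness of the extended valuation and separable extensions of henselian fields -/

namespace ValuedField

open Polynomial

theorem isIntegralPoly_prod {W Γ₀ : Type*} [Field W] [LinearOrderedCommGroupWithZero Γ₀]
    {v : Valuation W Γ₀} {s : Multiset W} (hs : ∀ r ∈ s, v r ≤ 1) :
    IsIntegralPoly v (s.map fun r => X - Polynomial.C r).prod := by
  lift s to Multiset v.valuationSubring using hs
  have : (s.map fun r : v.valuationSubring => X - Polynomial.C r).prod.map
      (algebraMap v.valuationSubring W) =
      ((s.map Subtype.val).map fun r => X - Polynomial.C r).prod := by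
    rw [Polynomial.map_multiset_prod, Multiset.map_map, Multiset.map_map]
    congr 1
    refine Multiset.map_congr rfl fun r _ => ?_
    simp
  exact this ▸ isIntegralPoly_map _

section Galois

variable {K N Γ₀ : Type*} [Field K] [Field N] [Algebra K N] [LinearOrderedCommGroupWithZero Γ₀]
  {v : Valuation N Γ₀}

/-- The intersection of the conjugates of the valuation ring. -/
def conjIntegers (K : Type*) [Field K] [Algebra K N] (v : Valuation N Γ₀) : Subring N where
  carrier := {y | ∀ σ : Gal(N/K), v (σ y) ≤ 1}
  zero_mem' σ := by simp
  one_mem' σ := by simp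
  add_mem' hx hy σ := by rw [map_add]; exact Valuation.map_add_le v (hx σ) (hy σ)
  neg_mem' hx σ := by rw [map_neg, Valuation.map_neg]; exact hx σ
  mul_mem' hx hy σ := by rw [map_mul, map_mul]; exact mul_le_one' (hx σ) (hy σ)

theorem map_mem_conjIntegers {y : N} (hy : y ∈ conjIntegers K v) (σ : Gal(N/K)) :
    σ y ∈ conjIntegers K v := fun τ => hy (τ * σ)

/-- These are the Horner tails b_j of P at its root t. If v(t) ≤ 1 they are visibly integral; if
v(t) > 1, use t b_{j+1} = b_j - p_j, starting from b_0 = P(t) = 0. -/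
theorem valuation_divX_le {P : N[X]} (hP : IsIntegralPoly v P) {t : N} (ht : P.eval t = 0)
    (j : ℕ) : v ((divX^[j] P).eval t) ≤ 1 := by
  have hcoeff : ∀ j i, (divX^[j] P).coeff i = P.coeff (i + j) := by
    intro j
    induction j with
    | zero => simp
    | succ j ih =>
      intro i
      rw [Function.iterate_succ_apply', coeff_divX, ih]
      congr 1; ring
  rcases le_or_gt (v t) 1 with h | h
  · refine IsIntegralPoly.eval_le (fun i => ?_) h
    rw [hcoeff]; exact hP _
  · induction j with
    | zero => simp [ht]
    | succ j ih =>
      have h1 := congrArg (Polynomial.eval t) (divX_mul_X_add (divX^[j] P))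
      rw [eval_add, eval_mul, eval_X, eval_C, ← Function.iterate_succ_apply' divX, hcoeff] at h1
      have h2 : v ((divX^[j + 1] P).eval t * t) ≤ 1 := by
        rw [eq_sub_of_add_eq h1]
        exact (Valuation.map_sub v _ _).trans (max_le ih (hP _))
      rw [map_mul] at h2
      by_contra! h3
      exact absurd h2 (not_le.2 (one_lt_mul_of_lt_of_le h3 h.le))

/-- Elements of the valuation ring are fractions of elements of the intersection of its
conjugates. -/
theorem exists_fraction [FiniteDimensional K N] {y : N} (hy : v y ≤ 1) :
    ∃ s ∈ conjIntegers K v, v s = 1 ∧ y * s ∈ conjIntegers K v := by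
  have halg : IsIntegral K y := IsIntegral.of_finite K y
  set P₀ := minpoly K y
  obtain ⟨i, hi, hmax⟩ := Finset.exists_max_image P₀.support (fun i => v (algebraMap K N (P₀.coeff i)))
    (by simpa using minpoly.ne_zero halg)
  have hne : P₀.coeff i ≠ 0 := mem_support_iff.1 hi
  set P := Polynomial.C (P₀.coeff i)⁻¹ * P₀ with hPdef
  have hPi : IsIntegralPoly v (P.map (algebraMap K N)) := by
    intro j
    rw [Polynomial.coeff_map, coeff_C_mul, map_mul, map_mul, map_inv₀, map_inv₀]
    by_cases hj : j ∈ P₀.support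
    · exact inv_mul_le_one_of_le₀ (hmax j hj) zero_le
    · simp [notMem_support_iff.1 hj]
  have hP1 : P.coeff i = 1 := by rw [hPdef, coeff_C_mul, inv_mul_cancel₀ hne]
  have hPy : aeval y P = 0 := by rw [hPdef, map_mul, minpoly.aeval, mul_zero]
  set b : ℕ → N := fun j => aeval y (divX^[j] P) with hb
  have hcoeff : ∀ j, (divX^[j] P).coeff 0 = P.coeff j := by
    have : ∀ j i, (divX^[j] P).coeff i = P.coeff (i + j) := by
      intro j
      induction j with
      | zero => simp
      | succ j ih =>
        intro i
        rw [Function.iterate_succ_apply', coeff_divX, ih]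
        congr 1; ring
    intro j
    rw [this, zero_add]
  have hmapdiv : ∀ j, (divX^[j] P).map (algebraMap K N) = divX^[j] (P.map (algebraMap K N)) := by
    intro j
    induction j with
    | zero => rfl
    | succ j ih =>
      rw [Function.iterate_succ_apply', Function.iterate_succ_apply', ← ih]
      ext n
      simp [coeff_divX]
  have hbR : ∀ j, b j ∈ conjIntegers K v := by
    intro j σ
    rw [hb, ← AlgEquiv.coe_toAlgHom, ← aeval_algHom_apply, ← eval_map_algebraMap, hmapdiv]
    refine valuation_divX_le hPi ?_ j
    rw [eval_map_algebraMap, aeval_algHom_apply, hPy, map_zero]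
  have hrec : ∀ j, y * b (j + 1) = b j - algebraMap K N (P.coeff j) := by
    intro j
    have h1 := congrArg (aeval y) (divX_mul_X_add (divX^[j] P))
    rw [map_add, map_mul, aeval_X, aeval_C, ← Function.iterate_succ_apply' divX, hcoeff] at h1
    simp only [hb]
    rw [mul_comm]
    exact eq_sub_of_add_eq h1
  have haR : ∀ j, algebraMap K N (P.coeff j) ∈ conjIntegers K v := fun j σ => by
    rw [AlgEquiv.commutes, ← Polynomial.coeff_map]
    exact hPi j
  have hyb : ∀ j, y * b (j + 1) ∈ conjIntegers K v := fun j => hrec j ▸ sub_mem (hbR j) (haR j)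
  have hle : ∀ j, v (b j) ≤ 1 := fun j => hbR j 1
  -- Since p_i = 1, y b_{i+1} = b_i - 1. If b_i is residually 0, this is a unit and so is b_{i+1};
  -- otherwise b_i is itself a unit, with i ≠ 0 because b_0 = P(y) = 0.
  rcases (hle i).lt_or_eq with h | h
  · have h1 : v (y * b (i + 1)) = 1 := by
      rw [hrec, hP1, map_one]
      rw [Valuation.map_sub_swap]
      exact (Valuation.map_one_sub_of_lt v h)
    refine ⟨b (i + 1), hbR _, le_antisymm (hle _) ?_, hyb i⟩
    rw [map_mul] at h1
    exact h1 ▸ mul_le_of_le_one_left' hy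
  · have hi0 : i ≠ 0 := by
      rintro rfl
      simp [hb, hPy] at h
    obtain ⟨j, rfl⟩ := Nat.exists_eq_succ_of_ne_zero hi0
    exact ⟨b (j + 1), hbR _, h, hyb j⟩

/-- The residual ideal of a conjugate of the valuation. -/
def conjIdeal (K : Type*) [Field K] [Algebra K N] (v : Valuation N Γ₀) (σ : Gal(N/K)) :
    Ideal (conjIntegers K v) where
  carrier := {y | v (σ y) < 1}
  zero_mem' := by simp
  add_mem' {x y} hx hy := by
    simp only [Set.mem_ofPred_eq, Subring.coe_add, map_add] at *
    exact Valuation.map_add_lt v hx hy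
  smul_mem' c x hx := by
    simp only [Set.mem_ofPred_eq, smul_eq_mul, Subring.coe_mul, map_mul] at *
    exact (mul_le_of_le_one_left' (c.2 σ)).trans_lt hx

theorem mem_conjIdeal {σ : Gal(N/K)} {y : conjIntegers K v} :
    y ∈ conjIdeal K v σ ↔ v (σ y) < 1 := Iff.rfl

/-- All roots of the minimal polynomial are conjugates of y, and these are integral. -/
theorem isIntegralPoly_minpoly [FiniteDimensional K N] [IsGalois K N] {y : N}
    (hy : y ∈ conjIntegers K v) : IsIntegralPoly v ((minpoly K y).map (algebraMap K N)) := by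
  have hm : (minpoly K y).Monic := minpoly.monic (IsIntegral.of_finite K y)
  rw [(Normal.splits (inferInstance : Normal K N) y).eq_prod_roots_of_monic (hm.map _)]
  refine isIntegralPoly_prod fun r hr => ?_
  have hr' := (mem_roots'.1 hr).2
  rw [IsRoot, eval_map_algebraMap] at hr'
  obtain ⟨σ, rfl⟩ := minpoly.exists_algEquiv_of_root' (IsIntegral.of_finite K y).isAlgebraic hr'
  exact hy σ

instance (σ : Gal(N/K)) : (conjIdeal K v σ).IsPrime where
  ne_top' h := by
    have : (1 : conjIntegers K v) ∈ conjIdeal K v σ := h ▸ trivial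
    simp [mem_conjIdeal] at this
  mem_or_mem' {x y} h := by
    by_contra! h'
    simp only [mem_conjIdeal, not_lt, Subring.coe_mul, map_mul] at h h'
    exact absurd h (not_lt.2 (one_le_mul h'.1 h'.2))

/-- The ring is integral over the valuation ring of K, and the ideal contracts to the maximal ideal
there. -/
theorem isMaximal_conjIdeal [FiniteDimensional K N] [IsGalois K N] (σ : Gal(N/K)) :
    (conjIdeal K v σ).IsMaximal := by
  let A := (v.comap (algebraMap K N)).valuationSubring
  have hA : ∀ a : A, algebraMap K N a ∈ conjIntegers K v := fun a τ => by
    rw [AlgEquiv.commutes]; exact a.2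
  let φ : A →+* conjIntegers K v := ((algebraMap K N).comp A.subtype).codRestrict _ hA
  refine Ideal.isMaximal_of_isIntegral_of_isMaximal_comap' φ ?_ _ ?_
  · intro y
    have h1 := isIntegralPoly_minpoly y.2
    have : minpoly K y.1 ∈ lifts A.subtype := by
      rw [lifts_iff_coeff_lifts]
      intro i
      refine ⟨⟨(minpoly K y.1).coeff i, ?_⟩, rfl⟩
      have := h1 i
      rwa [Polynomial.coeff_map] at this
    obtain ⟨P, hP, -, hPm⟩ := lifts_and_natDegree_eq_and_monic this
      (minpoly.monic (IsIntegral.of_finite K y.1))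
    refine ⟨P, hPm, (conjIntegers K v).subtype_injective ?_⟩
    rw [hom_eval₂, map_zero]
    have h2 := minpoly.aeval K y.1
    rw [← hP, aeval_def, eval₂_map] at h2
    exact h2
  · convert IsLocalRing.maximalIdeal.isMaximal A
    ext a
    rw [Ideal.mem_comap, mem_conjIdeal, Valuation.mem_maximalIdeal_iff]
    change v (σ (algebraMap K N a)) < 1 ↔ _
    rw [AlgEquiv.commutes]
    rfl

/-- Automorphisms over a henselian field preserve the valuation ring. -/
theorem valuation_galois_le_one [FiniteDimensional K N] [IsGalois K N]
    (hK : Hensel v (algebraMap K N).fieldRange) (σ₀ : Gal(N/K)) {y : N} (hy : v y ≤ 1) :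
    v (σ₀ y) ≤ 1 := by
  classical
  let D : Subgroup Gal(N/K) :=
    { carrier := {σ | ∀ y ∈ conjIntegers K v, v (σ y) < 1 ↔ v y < 1}
      one_mem' := fun y _ => Iff.rfl
      mul_mem' := fun {σ τ} hσ hτ y hy =>
        (hσ (τ y) (map_mem_conjIntegers hy τ)).trans (hτ y hy)
      inv_mem' := fun {σ} hσ y hy => by
        rw [← hσ _ (map_mem_conjIntegers hy σ⁻¹)]
        change v ((σ * σ⁻¹) y) < 1 ↔ _
        rw [mul_inv_cancel]; rfl }
  have hDmem : ∀ σ, σ ∈ D ↔ conjIdeal K v σ = conjIdeal K v 1 := by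
    intro σ
    constructor
    · exact fun h => Ideal.ext fun y => h y y.2
    · intro h y hy
      exact Ideal.ext_iff.1 h ⟨y, hy⟩
  have hD : ∀ σ, σ ∈ D := by
    by_contra! H
    obtain ⟨τ₀, hτ₀⟩ := H
    -- Chinese remainders, indexed by the distinct ideals rather than by the automorphisms: b is 1
    -- modulo the ideal of the identity and 0 modulo all the others.
    obtain ⟨b, hb⟩ := Ideal.exists_forall_sub_mem_ideal
      (I := fun i : Set.range (conjIdeal K v) => i.1) (by
        rintro ⟨_, σ, rfl⟩ ⟨_, τ, rfl⟩ hne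
        have := isMaximal_conjIdeal (v := v) σ
        have := isMaximal_conjIdeal (v := v) τ
        exact Ideal.isCoprime_of_isMaximal fun h => hne (Subtype.ext h))
      (fun i => if i.1 = conjIdeal K v 1 then 1 else 0)
    have hb1 : ∀ σ ∈ D, v (σ b - 1) < 1 := by
      intro σ hσ
      have := hb ⟨_, σ, rfl⟩
      rw [if_pos ((hDmem σ).1 hσ), mem_conjIdeal] at this
      simpa using this
    have hb0 : ∀ σ, σ ∉ D → v (σ b) < 1 := by
      intro σ hσ
      have := hb ⟨_, σ, rfl⟩
      rw [if_neg (fun h => hσ ((hDmem σ).2 h)), mem_conjIdeal] at this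
      simpa using this
    -- The norm over D is fixed by D, residually 1, and residually 0 after any automorphism outside
    -- D. Thus c is a simple residual root of its minimal polynomial near 1, so it lies in K; but
    -- then τ₀ fixes it, a contradiction.
    set c : N := ∏ σ : D, (σ : Gal(N/K)) b with hc
    have hcR : c ∈ conjIntegers K v := prod_mem fun σ _ => map_mem_conjIntegers b.2 _
    have hτc : ∀ τ, τ ∉ D → v (τ c) < 1 := by
      intro τ hτ
      rw [hc, map_prod, map_prod, ← Finset.mul_prod_erase _ _ (Finset.mem_univ (1 : D))]
      have hle : ∏ σ ∈ Finset.univ.erase (1 : D), v (τ ((σ : Gal(N/K)) b)) ≤ 1 :=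
        Finset.prod_le_one' fun σ _ => b.2 (τ * σ)
      refine (mul_le_of_le_one_right' hle).trans_lt ?_
      simpa using hb0 τ hτ
    have hσc : ∀ σ ∈ D, σ c = c := by
      intro σ hσ
      rw [hc, map_prod]
      exact Fintype.prod_equiv (Equiv.mulLeft ⟨σ, hσ⟩) _ _ fun τ => rfl
    have hc1 : v (c - 1) < 1 := by
      rw [hc]
      refine Finset.prod_induction _ (fun x => v (x - 1) < 1) (fun x y hx hy => ?_) (by simp)
        fun σ _ => hb1 σ σ.2
      rw [show x * y - 1 = (x - 1) * y + (y - 1) by ring]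
      refine Valuation.map_add_lt v ?_ hy
      rw [map_mul]
      exact (mul_le_of_le_one_right' (le_one_of_sub_lt (by simp) hy)).trans_lt hx
    have hcv : v c = 1 := by
      rw [← map_one v]
      refine Valuation.map_eq_of_sub_lt v ?_
      rwa [map_one]
    have hmc : (minpoly K c).Monic := minpoly.monic (IsIntegral.of_finite K c)
    set p := (minpoly K c).map (algebraMap K N) with hp
    have hpm : p.Monic := hmc.map _
    have hroot : p.eval c = 0 := by rw [hp, eval_map_algebraMap, minpoly.aeval]
    have hmem : c ∈ p.roots := (mem_roots hpm.ne_zero).2 hroot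
    have hder : p.derivative.eval c = ((p.roots.erase c).map fun r => c - r).prod := by
      have hprod : p = (p.roots.map fun r => X - Polynomial.C r).prod :=
        (Normal.splits (inferInstance : Normal K N) c).eq_prod_roots_of_monic hpm
      conv_lhs => rw [hprod, ← Multiset.cons_erase hmem]
      simp [derivative_mul, eval_multiset_prod]
    have hnodup : p.roots.Nodup :=
      nodup_roots (Polynomial.Separable.map (IsGalois.separable K c))
    have hder1 : v (p.derivative.eval c) = 1 := by
      rw [hder, map_multiset_prod, Multiset.map_map]
      refine Multiset.prod_eq_one fun x hx => ?_
      obtain ⟨r, hr, rfl⟩ := Multiset.mem_map.1 hx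
      rw [hnodup.mem_erase_iff] at hr
      have hr' := (mem_roots'.1 hr.2).2
      rw [IsRoot, hp, eval_map_algebraMap] at hr'
      obtain ⟨σ, rfl⟩ :=
        minpoly.exists_algEquiv_of_root' (IsIntegral.of_finite K c).isAlgebraic hr'
      have hσ : σ ∉ D := fun h => hr.1 (hσc σ h)
      rw [Function.comp_apply, ← hcv]
      refine Valuation.map_eq_of_sub_lt v ?_
      rw [sub_sub_cancel_left, Valuation.map_neg, hcv]
      exact hτc σ hσ
    have hcK : c ∈ (algebraMap K N).fieldRange :=
      hK.mem_of_root hpm (fun i => by rw [hp, Polynomial.coeff_map]; exact ⟨_, rfl⟩)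
        (isIntegralPoly_minpoly hcR) hroot (one_mem _) hcv.le hc1 hder1
    obtain ⟨d, hd⟩ := hcK
    have h1 := hτc τ₀ hτ₀
    rw [← hd, AlgEquiv.commutes, hd, hcv] at h1
    exact lt_irrefl _ h1
  -- Write y = (y s)/s; since σ₀ preserves the residual ideal, σ₀ s remains a unit.
  obtain ⟨s, hs, hs1, hys⟩ := exists_fraction (K := K) hy
  have h1 : v (σ₀ s) = 1 := by
    refine le_antisymm (hs σ₀) (not_lt.1 fun h => ?_)
    exact ((hD σ₀ s hs).1 h).ne hs1
  have h2 := hys σ₀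
  rwa [map_mul, map_mul, h1, mul_one] at h2

theorem valuation_galois_lt_one [FiniteDimensional K N] [IsGalois K N]
    (hK : Hensel v (algebraMap K N).fieldRange) (σ : Gal(N/K)) {y : N} (hy : v y < 1) :
    v (σ y) < 1 := by
  by_contra! h
  have h1 : v (σ y)⁻¹ ≤ 1 := by rw [map_inv₀]; exact inv_le_one_of_one_le₀ h
  have h2 := valuation_galois_le_one hK σ⁻¹ h1
  rw [map_inv₀, map_inv₀] at h2
  have h3 : σ⁻¹ (σ y) = y := σ.symm_apply_apply y
  rw [h3] at h2
  by_cases hy0 : y = 0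
  · rw [hy0] at h; simp at h
  · refine absurd h2 (not_le.2 ((one_lt_inv₀ ?_).2 hy))
    rw [zero_lt_iff]; simpa using hy0

end Galois

/-- Henselianity is transported along embeddings of valued fields. -/
theorem hensel_map_iff {N W Γ₀ Γ₁ : Type*} [Field N] [Field W] [LinearOrderedCommGroupWithZero Γ₀]
    [LinearOrderedCommGroupWithZero Γ₁] {u : Valuation N Γ₀} {v : Valuation W Γ₁} (φ : N →+* W)
    (h : ∀ x y, u x ≤ u y ↔ v (φ x) ≤ v (φ y)) {E : Subfield N} :
    Hensel v (E.map φ) ↔ Hensel u E := by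
  have hle : ∀ x, u x ≤ 1 ↔ v (φ x) ≤ 1 := fun x => by simpa using h x 1
  have hlt : ∀ x, u x < 1 ↔ v (φ x) < 1 := fun x => by
    rw [← not_le, ← not_le, ← map_one u, h, map_one φ, map_one]
  have heq : ∀ x, u x = 1 ↔ v (φ x) = 1 := fun x =>
    ⟨fun e => le_antisymm ((hle x).1 e.le) (not_lt.1 fun h' => ((hlt x).2 h').ne e),
      fun e => le_antisymm ((hle x).2 e.le) (not_lt.1 fun h' => ((hlt x).1 h').ne e)⟩
  have hpoly : ∀ f, IsIntegralPoly v (f.map φ) ↔ IsIntegralPoly u f := fun f =>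
    forall_congr' fun i => by rw [Polynomial.coeff_map, hle]
  constructor
  · intro H f hf hfE hfi a ha ha1 h0 h1
    obtain ⟨_, ⟨x, hx, rfl⟩, hx0, hxa⟩ := H (f.map φ) (hf.map φ)
      (fun i => by rw [Polynomial.coeff_map]; exact ⟨_, hfE i, rfl⟩) ((hpoly f).2 hfi) (φ a)
      ⟨a, ha, rfl⟩ ((hle a).1 ha1) (by rw [eval_map_apply, ← hlt]; exact h0)
      (by rw [derivative_map, eval_map_apply, ← heq]; exact h1)
    refine ⟨x, hx, φ.injective ?_, ?_⟩
    · rw [← eval_map_apply, hx0, map_zero]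
    · rw [hlt, map_sub]; exact hxa
  · intro H f hf hfE hfi a ha ha1 h0 h1
    obtain ⟨a, ha, rfl⟩ := ha
    obtain ⟨F, rfl⟩ : ∃ F : N[X], F.map φ = f :=
      (lifts_iff_coeff_lifts f).2 fun i => by
        obtain ⟨x, -, hx⟩ := hfE i
        exact ⟨x, hx⟩
    rw [eval_map_apply, ← hlt] at h0
    rw [derivative_map, eval_map_apply, ← heq] at h1
    obtain ⟨x, hx, hx0, hxa⟩ := H F (monic_of_injective φ.injective hf) (fun i => by
      obtain ⟨y, hy, hy'⟩ := hfE i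
      rw [Polynomial.coeff_map] at hy'
      exact φ.injective hy' ▸ hy) ((hpoly F).1 hfi) a ha ((hle a).2 ha1) h0 h1
    refine ⟨φ x, ⟨x, hx, rfl⟩, ?_, ?_⟩
    · rw [eval_map_apply, hx0, map_zero]
    · rw [← map_sub, ← hlt]; exact hxa

variable {W Γ₀ : Type*} [Field W] [LinearOrderedCommGroupWithZero Γ₀] {v : Valuation W Γ₀}

/-- Conjugates over a henselian field of an element of the maximal ideal lie in the maximal
ideal. -/
theorem valuation_conj_lt_one [IsAlgClosed W] {K : Subfield W} (hK : Hensel v K) {y y' : W}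
    (hsep : IsSeparable K y) (hy : v y < 1) (hy' : aeval y' (minpoly K y) = 0) : v y' < 1 := by
  obtain ⟨p, hp⟩ : ∃ p, p = minpoly K y := ⟨_, rfl⟩
  have hp0 : p ≠ 0 := hp ▸ minpoly.ne_zero hsep.isIntegral
  let N := IntermediateField.adjoin K (p.rootSet W)
  have := IntermediateField.adjoin_rootSet_isSplittingField
    (IsAlgClosed.splits (p.map (algebraMap K W)))
  have hps : p.Separable := hp ▸ hsep
  have : IsGalois K N := IsGalois.of_separable_splitting_field hps
  have : FiniteDimensional K N := IsSplittingField.finiteDimensional N p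
  have hmem : ∀ x : W, aeval x p = 0 → x ∈ N := fun x hx =>
    IntermediateField.subset_adjoin _ _ ((mem_rootSet.2 ⟨hp0, hx⟩))
  rw [← hp] at hy'
  obtain ⟨y, rfl⟩ : ∃ y₀ : N, (y₀ : W) = y := ⟨⟨y, hmem y (hp ▸ minpoly.aeval K y)⟩, rfl⟩
  obtain ⟨y', rfl⟩ : ∃ y₀ : N, (y₀ : W) = y' := ⟨⟨y', hmem y' hy'⟩, rfl⟩
  have hmin : minpoly K y = p := hp ▸ (minpoly.algebraMap_eq N.val.injective y).symm
  obtain ⟨σ, rfl⟩ := minpoly.exists_algEquiv_of_root' (x := y') (y := y)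
    (IsIntegral.of_finite K y).isAlgebraic (by
      rw [hmin]
      exact Subtype.ext ((aeval_algHom_apply N.val y' p).symm.trans hy'))
  refine valuation_galois_lt_one (v := v.comap (algebraMap N W)) ?_ σ hy
  rw [← hensel_map_iff (v := v) (algebraMap N W) (fun x y => Iff.rfl)]
  convert hK
  ext x
  constructor
  · rintro ⟨_, ⟨a, rfl⟩, rfl⟩
    exact a.2
  · intro hx
    exact ⟨_, ⟨⟨x, hx⟩, rfl⟩, rfl⟩

theorem isSeparable_of_simple_root {K W : Type*} [Field K] [Field W] [Algebra K W] {F : K[X]}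
    {x : W} (hF : aeval x F = 0) (hd : aeval x (derivative F) ≠ 0) : IsSeparable K x := by
  have hF0 : F ≠ 0 := by
    rintro rfl
    simp at hd
  have hint : IsIntegral K x := IsAlgebraic.isIntegral ⟨F, hF0, hF⟩
  rw [IsSeparable, separable_iff_derivative_ne_zero (minpoly.irreducible hint)]
  intro h
  obtain ⟨q, hq⟩ := minpoly.dvd K x hF
  refine hd ?_
  rw [hq, derivative_mul, h, zero_mul, zero_add, map_mul, minpoly.aeval, zero_mul]

/-- A separable algebraic extension of a henselian field is henselian. -/
theorem Hensel.of_separable [IsAlgClosed W] {K L : Subfield W} (hK : Hensel v K) (hKL : K ≤ L)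
    (hsep : ∀ x ∈ L, IsSeparable K x) : Hensel v L := by
  let : Algebra K L := (Subfield.inclusion hKL).toAlgebra
  have : IsScalarTower K L W := .of_algebraMap_eq fun _ => rfl
  have hmin : ∀ x : L, minpoly K x = minpoly K x.1 := fun x =>
    (minpoly.algebraMap_eq (A := K) (B := L) (B' := W) L.subtype.injective x).symm
  have : Algebra.IsSeparable K L := ⟨fun x => by
    rw [IsSeparable, hmin]; exact hsep x x.2⟩
  intro f hf hfL hfi a haL ha h0 h1
  obtain ⟨x, -, hx, hxa⟩ := hensel_top (v := v) f hf (fun _ => trivial) hfi a trivial ha h0 h1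
  refine ⟨x, ?_, hx, hxa⟩
  have hder : v (f.derivative.eval x) = 1 := hfi.derivative.eval_eq_one ha hxa h1
  obtain ⟨F, rfl⟩ := exists_map_subtype hfL
  have hFx : aeval x F = 0 := by rwa [eval_map] at hx
  have hsx : IsSeparable L x := by
    refine isSeparable_of_simple_root hFx fun hd => ?_
    rw [derivative_map, eval_map] at hder
    change v (aeval x (derivative F)) = 1 at hder
    rw [hd, map_zero] at hder
    exact zero_ne_one hder
  have hKsep : IsSeparable K (x - a) :=
    Field.isSeparable_sub (IsSeparable.of_algebra_isSeparable_of_isSeparable K hsx) (hsep a haL)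
  -- A second conjugate y of x over L would make y - a conjugate to x - a over K, hence of value
  -- below 1; two roots would then lift the same simple residual root.
  by_contra hxL
  obtain ⟨y, hxy, hconj⟩ := (notMem_iff_exists_ne_and_isConjRoot hsx
    (IsAlgClosed.splits _)).1 (fun h => by
      obtain ⟨c, hc⟩ := Algebra.mem_bot.1 h
      exact hxL (hc ▸ c.2))
  have hconj' : IsConjRoot K (x - a) (y - a) :=
    (hconj.sub_algebraMap (⟨a, haL⟩ : L)).of_isScalarTower hKsep.isIntegral
  have hya := valuation_conj_lt_one hK hKsep hxa hconj'.aeval_eq_zero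
  have hy0 : (F.map L.subtype).eval y = 0 := by
    obtain ⟨q, hq⟩ := minpoly.dvd L x hFx
    rw [eval_map]
    change aeval y F = 0
    rw [hq, map_mul, hconj.aeval_eq_zero, zero_mul]
  refine hxy (hfi.root_unique hy0 hx (le_one_of_sub_lt ha hxa) ?_ hder).symm
  rw [← sub_sub_sub_cancel_right y x a]
  exact (Valuation.map_sub v _ _).trans_lt (max_lt hya hxa)

end ValuedField

/-! ### Recovering monomials in henselian fields -/

namespace PowerSeriesField

open Polynomial ValuedField

variable {k G : Type*} [Field k] [AddCommGroup G] [LinearOrder G] [IsOrderedAddMonoid G]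

section Embedding

variable {W Γ₀ : Type*} [Field W] [LinearOrderedCommGroupWithZero Γ₀] {v : Valuation W Γ₀}
  {φ : HahnSeries G k →+* W}

variable (v φ) in
/-- An embedding of `k((G))` into a valued field that preserves the valuation. -/
def IsValuedEmbedding : Prop :=
  ∀ x y, hahnVal k G x ≤ hahnVal k G y ↔ v (φ x) ≤ v (φ y)

theorem isValuedEmbedding_id : IsValuedEmbedding (hahnVal k G) (RingHom.id (HahnSeries G k)) :=
  fun _ _ => Iff.rfl

namespace IsValuedEmbedding

variable (hφ : IsValuedEmbedding v φ)
include hφ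

theorem lt_iff {x y : HahnSeries G k} :
    v (φ x) < v (φ y) ↔ y.orderTop < x.orderTop := by
  rw [← not_le, ← hφ, hahnVal_le, not_le]

theorem le_iff {x y : HahnSeries G k} :
    v (φ x) ≤ v (φ y) ↔ y.orderTop ≤ x.orderTop := by
  rw [← hφ, hahnVal_le]

theorem eq_iff {x y : HahnSeries G k} :
    v (φ x) = v (φ y) ↔ y.orderTop = x.orderTop := by
  rw [le_antisymm_iff, le_antisymm_iff, hφ.le_iff, hφ.le_iff]

theorem leadEq_iff {x y : HahnSeries G k} :
    LeadEq v (φ x) (φ y) ↔ LeadEq (hahnVal k G) x y := by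
  rw [LeadEq, LeadEq, φ.injective.eq_iff, ← map_sub, hφ.lt_iff, hahnVal_lt]

theorem map_const {a : k} (ha : a ≠ 0) : v (φ (single 0 a)) = 1 := by
  rw [← map_one v, ← map_one φ, hφ.eq_iff, orderTop_one, orderTop_single ha]
  rfl

theorem map_const_le (a : k) : v (φ (single 0 a)) ≤ 1 := by
  by_cases ha : a = 0
  · simp [ha]
  · exact (hφ.map_const ha).le

end IsValuedEmbedding

end Embedding

theorem natCast_ne_zero_of_coprime {F : Subfield k} {e : ℕ} (he : 0 < e)
    (h : e.Coprime (ringExpChar F)) : (e : k) ≠ 0 := by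
  have hF : (e : F) ≠ 0 := by
    have hexp := ringExpChar.expChar F
    generalize ringExpChar F = q at h hexp
    rcases hexp with _ | hp
    · exact Nat.cast_ne_zero.2 he.ne'
    · rw [Ne, CharP.cast_eq_zero_iff F q]
      intro hd
      have := Nat.Coprime.eq_one_of_dvd h.symm hd
      exact hp.one_lt.ne' this
  intro h0
  refine hF (Subtype.ext ?_)
  simpa using h0

/-- The constants of the residue field, inside a field that contains its monomials. -/
noncomputable def constHom (K : Subfield (HahnSeries G k))
    (hmon : ∀ a ∈ residueField K, ∀ g ∈ valueGroup K, single g a ∈ K) : residueField K →+* K :=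
  ((C : k →+* HahnSeries G k).comp (residueField K).subtype).codRestrict K fun a =>
    hmon a a.2 0 (zero_mem _)

section Monomial

variable {K : Subfield (HahnSeries G k)}
  (hmon : ∀ a ∈ residueField K, ∀ g ∈ valueGroup K, single g a ∈ K)
  {c : k} {γ : G} (hc : IsSeparable (residueField K) c)
  (hγ : ∃ e : ℕ, 0 < e ∧ e.Coprime (ringExpChar (residueField K)) ∧ e • γ ∈ valueGroup K)
include hmon hc hγ

/-- The monomial is a simple root of f(t^{-eγ} X^e), where f is the minimal polynomial of c^e over
Kv: f is separable and e is nonzero in k. -/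
theorem isSeparable_single : IsSeparable K (single γ c) := by
  by_cases hc0 : c = 0
  · rw [hc0, single_eq_zero]
    exact isSeparable_of_simple_root (F := X) (by simp) (by simp)
  obtain ⟨e, he, hcop, hev⟩ := hγ
  have hek := natCast_ne_zero_of_coprime he hcop
  have hce : IsSeparable (residueField K) (c ^ e) := mem_separableClosure_iff.1 (pow_mem (mem_separableClosure_iff.2 hc) e)
  set f := minpoly (residueField K) (c ^ e)
  have ht : single (-(e • γ)) (1 : k) ∈ K := hmon 1 (one_mem _) _ (neg_mem hev)
  let F : K[X] := (f.map (constHom K hmon)).comp (Polynomial.C ⟨_, ht⟩ * X ^ e)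
  have hval : single (-(e • γ)) (1 : k) * single γ c ^ e = HahnSeries.C (c ^ e) := by
    rw [single_pow, single_mul_single, one_mul, neg_add_cancel]; rfl
  have haeval : ∀ p : (residueField K)[X],
      aeval (HahnSeries.C (c ^ e) : HahnSeries G k) (p.map (constHom K hmon)) = HahnSeries.C (aeval (c ^ e) p) := by
    intro p
    rw [aeval_def, eval₂_map, aeval_def, hom_eval₂]
    rfl
  have hin : aeval (single γ c) (Polynomial.C (⟨_, ht⟩ : K) * X ^ e) =
      (HahnSeries.C (c ^ e) : HahnSeries G k) := by
    rw [map_mul, aeval_C, map_pow, aeval_X, ← hval]; rfl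
  refine isSeparable_of_simple_root (F := F) ?_ ?_
  · rw [aeval_comp, hin, haeval, minpoly.aeval, map_zero]
  · rw [derivative_comp, map_mul, aeval_comp, hin, derivative_map, haeval]
    refine mul_ne_zero ?_ ?_
    · rw [derivative_C_mul_X_pow, map_mul, aeval_C, map_pow, aeval_X]
      refine mul_ne_zero ?_ (pow_ne_zero _ (single_ne_zero hc0))
      rw [map_mul, map_natCast]
      refine mul_ne_zero (single_ne_zero one_ne_zero) ?_
      rw [← map_natCast (C : k →+* HahnSeries G k)]
      exact (_root_.map_ne_zero _).2 hek
    · exact (_root_.map_ne_zero _).2 (hce.aeval_derivative_ne_zero (minpoly.aeval _ _))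

/-- A henselian field that contains an element with the leading term of a tame separable monomial
contains the monomial. -/
theorem single_mem_of_leadEq {W Γ₀ : Type*} [Field W] [LinearOrderedCommGroupWithZero Γ₀]
    {v : Valuation W Γ₀} {φ : HahnSeries G k →+* W} (hφ : IsValuedEmbedding v φ) {E : Subfield W}
    (hE : Hensel v E) (hKE : ∀ x ∈ K, φ x ∈ E) {w : W} (hw : w ∈ E)
    (h : LeadEq v (φ (single γ c)) w) : φ (single γ c) ∈ E := by
  by_cases hc0 : c = 0
  · rw [hc0, single_eq_zero, map_zero]; exact zero_mem _
  obtain ⟨e, he, hcop, hev⟩ := hγ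
  have hek := natCast_ne_zero_of_coprime he hcop
  have hce : IsSeparable (residueField K) (c ^ e) := mem_separableClosure_iff.1 (pow_mem (mem_separableClosure_iff.2 hc) e)
  have ht : single (-(e • γ)) (1 : k) ∈ K := hmon 1 (one_mem _) _ (neg_mem hev)
  have ht' : single (e • γ) (1 : k) ∈ K := hmon 1 (one_mem _) _ hev
  have hval : single γ c ^ e * single (-(e • γ)) (1 : k) = single 0 (c ^ e) := by
    rw [single_pow, single_mul_single, mul_one, add_neg_cancel]
  have hval' : single γ c ^ e = single 0 (c ^ e) * single (e • γ) (1 : k) := by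
    rw [single_pow, single_mul_single, mul_one, zero_add]
  -- Only t^{eγ} is available in K, so c^e is recovered before c: w^e t^{-eγ} approximates it, and
  -- it is a simple residual root over Kv.
  have hconst : φ (single 0 (c ^ e)) ∈ E := by
    let ψ : residueField K →+* W := φ.comp ((C : k →+* HahnSeries G k).comp (residueField K).subtype)
    have hψ : ∀ p : (residueField K)[X],
        (p.map ψ).eval (φ (single 0 (c ^ e))) = φ (single 0 (aeval (c ^ e) p)) := by
      intro p
      rw [eval_map, aeval_def]
      have h1 := hom_eval₂ p (algebraMap (residueField K) k)
        (φ.comp (C : k →+* HahnSeries G k)) (c ^ e)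
      exact h1.symm
    refine hE.mem_of_root (f := (minpoly (residueField K) (c ^ e)).map ψ)
      ((minpoly.monic hce.isIntegral).map _) (fun i => ?_) (fun i => ?_) ?_
      (mul_mem (pow_mem hw e) (hKE _ ht)) (hφ.map_const_le _) ?_ ?_
    · rw [Polynomial.coeff_map]
      exact hKE _ (hmon _ (Subtype.prop _) 0 (zero_mem _))
    · rw [Polynomial.coeff_map]
      exact hφ.map_const_le _
    · rw [hψ, minpoly.aeval, single_eq_zero, map_zero]
    · refine LeadEq.sub_lt_one ?_ (hφ.map_const_le _)
      rw [← hval, map_mul, map_pow]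
      exact (h.pow e).mul (.refl _)
    · rw [derivative_map, hψ]
      exact hφ.map_const (hce.aeval_derivative_ne_zero (minpoly.aeval _ _))
  set m := φ (single γ c) with hm
  have hm0 : m ≠ 0 := (map_ne_zero φ).2 (single_ne_zero hc0)
  have hw0 : w ≠ 0 := fun h0 => hm0 (h.eq_zero_iff.2 h0)
  have hme : m ^ e ∈ E := by
    rw [hm, ← map_pow, hval', map_mul]
    exact mul_mem hconst (hKE _ ht')
  have hlead : LeadEq v 1 (w / m) := by
    have := h.div (.refl m)
    rwa [div_self hm0] at this
  have hv : v (w / m) = 1 := by rw [← hlead.map_eq, map_one]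
  -- w/m is residually 1 and its e-th power lies in E; as e is a unit, it is a simple residual root
  -- of X^e - w^e/m^e.
  have hwm : w / m ∈ E := by
    refine hE.mem_of_root (f := X ^ e - Polynomial.C (w ^ e / m ^ e))
      (monic_X_pow_sub_C _ he.ne') (fun i => ?_) (fun i => ?_) (b := 1) ?_ (one_mem _) hv.le
      (hlead.symm.sub_lt_one hv.le) ?_
    · rw [Polynomial.coeff_sub, coeff_X_pow, Polynomial.coeff_C]
      refine sub_mem ?_ ?_
      · split_ifs
        · exact one_mem _
        · exact zero_mem _
      · split_ifs
        · exact div_mem (pow_mem hw e) hme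
        · exact zero_mem _
    · rw [Polynomial.coeff_sub, coeff_X_pow, Polynomial.coeff_C, ← div_pow]
      refine (Valuation.map_sub v _ _).trans (max_le ?_ ?_)
      · split_ifs <;> simp
      · split_ifs
        · rw [map_pow, hv, one_pow]
        · simp
    · simp [div_pow]
    · have hev : v (e : W) = 1 := by
        rw [← hφ.map_const hek]
        congr 1
        change _ = φ (C (e : k))
        rw [map_natCast, map_natCast]
      simp [derivative_X_pow, hev, hv]
  have : m = w / (w / m) := by field_simp
  rw [this]
  exact div_mem hw hwm

end Monomial

section Sum

variable {c : ℕ → k} {γ : ℕ → G}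

/-- The partial sums of the series. -/
noncomputable def partialSum (c : ℕ → k) (γ : ℕ → G) (n : ℕ) : HahnSeries G k :=
  ∑ i ∈ Finset.range n, single (γ i) (c i)

omit [AddCommGroup G] [IsOrderedAddMonoid G] in
-- Below γ n only the terms with index less than n contribute. Equality may fail, as c n may be 0.
theorem le_orderTop_sub_partialSum (hγ : StrictMono γ) (n : ℕ) :
    (γ n : WithTop G) ≤ (powerSeries c γ hγ - partialSum c γ n).orderTop := by
  rw [le_orderTop_iff_forall]
  intro g hg
  rw [WithTop.coe_lt_coe] at hg
  rw [HahnSeries.coeff_sub, sub_eq_zero, powerSeries, SummableFamily.coeff_hsum, partialSum,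
    HahnSeries.coeff_sum]
  refine finsum_eq_finsetSum_of_support_subset _ fun i hi => ?_
  have hi' : (single (γ i) (c i)).coeff g ≠ 0 := hi
  have : g = γ i := by
    by_contra h
    exact hi' (coeff_single_of_ne h)
  rw [this] at hg
  simpa using hγ.lt_iff_lt.1 hg

variable {K : Subfield (HahnSeries G k)}
  (hmon : ∀ a ∈ residueField K, ∀ g ∈ valueGroup K, single g a ∈ K)
  (hsep : ∀ i, IsSeparable (residueField K) (c i))
  (htame : ∀ i, ∃ e : ℕ, 0 < e ∧ e.Coprime (ringExpChar (residueField K)) ∧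
    e • γ i ∈ valueGroup K)
include hmon hsep htame

/-- A henselian field over `K` that contains a pseudo-limit of the partial sums contains all of
the monomials. -/
theorem single_mem_of_pseudo_limit (hγ : StrictMono γ) {W Γ₀ : Type*} [Field W]
    [LinearOrderedCommGroupWithZero Γ₀]
    {v : Valuation W Γ₀} {φ : HahnSeries G k →+* W} (hφ : IsValuedEmbedding v φ) {E : Subfield W}
    (hE : Hensel v E) (hKE : ∀ x ∈ K, φ x ∈ E) {r : W} (hr : r ∈ E)
    (h : ∀ n, v (r - φ (partialSum c γ n)) ≤ v (φ (single (γ n) 1))) (i : ℕ) :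
    φ (single (γ i) (c i)) ∈ E := by
  induction i using Nat.strong_induction_on with
  | _ i ih =>
    by_cases hc : c i = 0
    · rw [hc, single_eq_zero, map_zero]; exact zero_mem _
    have hs : φ (partialSum c γ i) ∈ E := by
      rw [partialSum, map_sum]
      exact sum_mem fun j hj => ih j (Finset.mem_range.1 hj)
    refine single_mem_of_leadEq hmon (hsep i) (htame i) hφ hE hKE (sub_mem hr hs) (Or.inr ?_)
    -- The error of the candidate r - (partial sum) is the next remainder, of value at least γ_{i+1}
    -- > γ_i. The monomial with coefficient 1 serves only to name the value γ_{i+1}, since c (i+1)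
    -- may vanish.
    have e : φ (single (γ i) (c i)) - (r - φ (partialSum c γ i)) =
        -(r - φ (partialSum c γ (i + 1))) := by
      rw [partialSum, partialSum, Finset.sum_range_succ, map_add]; ring
    rw [e, Valuation.map_neg]
    refine (h (i + 1)).trans_lt (hφ.lt_iff.2 ?_)
    rw [orderTop_single hc, orderTop_single one_ne_zero, WithTop.coe_lt_coe]
    exact hγ (Nat.lt_succ_self i)

end Sum

end PowerSeriesField

/-! ### Leading terms of linear combinations, and finiteness of exponents and constants -/

namespace PowerSeriesField

open ValuedField

variable {k G : Type*} [Field k] [AddCommGroup G] [LinearOrder G] [IsOrderedAddMonoid G]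

theorem leadEq_single (y : HahnSeries G k) :
    LeadEq (hahnVal k G) y (single y.order y.leadingCoeff) := by
  by_cases h0 : y = 0
  · left; simp [h0]
  right
  rw [hahnVal_lt]
  have hl : y.leadingCoeff ≠ 0 := leadingCoeff_ne_zero.2 h0
  have hy : y.orderTop = y.order := (order_eq_orderTop_of_ne_zero h0).symm
  refine lt_of_le_of_ne ?_ fun h => ?_
  · have := min_orderTop_le_orderTop_sub (x := y) (y := single y.order y.leadingCoeff)
    rwa [orderTop_single hl, hy, min_self, ← hy] at this
  · rw [hy] at h
    refine coeff_orderTop_ne h.symm ?_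
    rw [HahnSeries.coeff_sub, coeff_single_same, leadingCoeff_eq, sub_self]

omit [AddCommGroup G] [IsOrderedAddMonoid G] in
theorem sum_single_eq {ι : Type*} (J : Finset ι) (δ : G) (f : ι → k) :
    ∑ j ∈ J, single δ (f j) = single δ (∑ j ∈ J, f j) :=
  (map_sum (single.addMonoidHom δ : k →+ HahnSeries G k) f J).symm

theorem coe_ne_zero_iff {F : Type*} [Field F] {K : Subfield F} {x : K} : (x : F) ≠ 0 ↔ x ≠ 0 :=
  ZeroMemClass.coe_eq_zero.not

section

variable {K : Subfield (HahnSeries G k)}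
  (hmon : ∀ a ∈ residueField K, ∀ g ∈ valueGroup K, single g a ∈ K)
include hmon

theorem coeff_mem_residueField {y : HahnSeries G k} (hy : y ∈ K) {δ : G} (hδ : δ ∈ valueGroup K)
    (h : (δ : WithTop G) ≤ y.orderTop) : y.coeff δ ∈ residueField K := by
  have ht : single (-δ) (1 : k) ∈ K := hmon 1 (one_mem _) _ (neg_mem hδ)
  refine ⟨y * single (-δ) 1, ⟨mul_mem hy ht, ?_⟩, ?_⟩
  · refine mem_integers.2 ?_
    rw [orderTop_mul, orderTop_single one_ne_zero]
    have := add_le_add_left h ((-δ : G) : WithTop G)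
    rwa [← WithTop.coe_add, add_neg_cancel] at this
  · have := coeff_mul_single_add (x := y) (r := (1 : k)) (a := δ) (b := -δ)
    rwa [add_neg_cancel, mul_one] at this

theorem leadingCoeff_mem_residueField {y : HahnSeries G k} (hy : y ∈ K) :
    y.leadingCoeff ∈ residueField K := by
  by_cases h0 : y = 0
  · rw [h0, leadingCoeff_zero]; exact zero_mem _
  · rw [leadingCoeff_eq]
    exact coeff_mem_residueField hmon hy ⟨y, hy, h0, rfl⟩ (order_eq_orderTop_of_ne_zero h0).le

theorem single_lead_mem {y : HahnSeries G k} (hy : y ∈ K) :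
    single y.order y.leadingCoeff ∈ K := by
  by_cases h0 : y = 0
  · rw [h0, leadingCoeff_zero, single_eq_zero]; exact zero_mem _
  · exact hmon _ (leadingCoeff_mem_residueField hmon hy) _ ⟨y, hy, h0, rfl⟩

/-- A linear combination over `K` of linearly independent monomials has the leading term of a
monomial. This persists if the monomials are replaced by elements with the same leading terms. -/
theorem exists_lead_monomial {ι W Γ₀ : Type*} [Field W] [LinearOrderedCommGroupWithZero Γ₀]
    {v : Valuation W Γ₀} {φ : HahnSeries G k →+* W} (hφ : IsValuedEmbedding v φ) (J : Finset ι)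
    (g : ι → G) (b : ι → k)
    (hli : ∀ a : ι → K, ∑ j ∈ J, (a j : HahnSeries G k) * single (g j) (b j) = 0 →
      ∀ j ∈ J, a j = 0)
    (a : ι → K) (ha : ∃ j ∈ J, a j ≠ 0) :
    ∃ J₀ ⊆ J, J₀.Nonempty ∧ ∃ δ : G, (∀ j ∈ J₀, a j ≠ 0 ∧ (a j).1.order + g j = δ) ∧
      ∑ j ∈ J₀, (a j).1.leadingCoeff * b j ≠ 0 ∧
      ∀ d : ι → W, (∀ j ∈ J, LeadEq v (φ (single (g j) (b j))) (d j)) →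
        LeadEq v (φ (single δ (∑ j ∈ J₀, (a j).1.leadingCoeff * b j)))
          (∑ j ∈ J, φ (a j) * d j) := by
  classical
  have hb : ∀ j ∈ J, b j ≠ 0 := by
    intro j hj h0
    have := hli (Pi.single j 1) (by
      rw [Finset.sum_eq_single j (by simp +contextual) (by simp +contextual [hj])]
      simp [h0]) j hj
    simp at this
  obtain ⟨j1, hj1, ha1⟩ := ha
  obtain ⟨j0, hj0, hmax⟩ := Finset.exists_max_image J
    (fun j => hahnVal k G ((a j : HahnSeries G k) * single (g j) (b j))) ⟨j1, hj1⟩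
  set m : ι → HahnSeries G k := fun j => (a j : HahnSeries G k) * single (g j) (b j) with hm
  have hm0 : ∀ j ∈ J, m j ≠ 0 ↔ a j ≠ 0 := by
    intro j hj
    rw [hm, mul_ne_zero_iff, coe_ne_zero_iff]
    exact and_iff_left (single_ne_zero (hb j hj))
  have hpos : 0 < hahnVal k G (m j0) := by
    refine lt_of_lt_of_le ?_ (hmax j1 hj1)
    rw [zero_lt_iff, Valuation.ne_zero_iff]
    exact (hm0 j1 hj1).2 ha1
  -- The terms of least order; all others are negligible for the leading term.
  set J₀ := J.filter fun j => hahnVal k G (m j) = hahnVal k G (m j0) with hJ₀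
  have hJ0 : ∀ j ∈ J₀, j ∈ J ∧ hahnVal k G (m j) = hahnVal k G (m j0) := fun j hj =>
    Finset.mem_filter.1 hj
  have hj00 : j0 ∈ J₀ := Finset.mem_filter.2 ⟨hj0, rfl⟩
  have hne : ∀ j ∈ J₀, m j ≠ 0 := by
    intro j hj
    rw [← Valuation.ne_zero_iff (hahnVal k G), (hJ0 j hj).2]
    exact hpos.ne'
  have hane : ∀ j ∈ J₀, a j ≠ 0 := fun j hj => (hm0 j (hJ0 j hj).1).1 (hne j hj)
  have horder : ∀ j ∈ J₀, (a j).1.order + g j = (m j0).order := by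
    intro j hj
    have h1 : (m j).order = (m j0).order := by
      have := hahnVal_eq.1 (hJ0 j hj).2
      rw [← order_eq_orderTop_of_ne_zero (hne j hj), ← order_eq_orderTop_of_ne_zero (hne j0 hj00),
        WithTop.coe_inj] at this
      exact this.symm
    rw [← h1, hm, order_mul (coe_ne_zero_iff.2 (hane j hj))
      (single_ne_zero (hb j (hJ0 j hj).1)), order_single (hb j (hJ0 j hj).1)]
  have hterm : ∀ j ∈ J₀, single (a j).1.order (a j).1.leadingCoeff * single (g j) (b j) =
      single (m j0).order ((a j).1.leadingCoeff * b j) := by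
    intro j hj
    rw [single_mul_single, horder j hj]
  -- The leading monomials of the a j lie in K, so cancellation of leading coefficients would be a
  -- K-linear relation among the given monomials.
  have hβ : ∑ j ∈ J₀, (a j).1.leadingCoeff * b j ≠ 0 := by
    intro h0
    have h1 := hli (fun j => if j ∈ J₀ then
      ⟨single (a j).1.order (a j).1.leadingCoeff, single_lead_mem hmon (a j).2⟩ else 0) (by
        have h2 : ∀ j ∈ J, ((if j ∈ J₀ then (⟨single (a j).1.order (a j).1.leadingCoeff,
            single_lead_mem hmon (a j).2⟩ : K) else 0 : K) : HahnSeries G k) *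
            single (g j) (b j) = if j ∈ J₀ then
              single (m j0).order ((a j).1.leadingCoeff * b j) else 0 := by
          intro j _
          split_ifs with h
          · exact hterm j h
          · simp
        rw [Finset.sum_congr rfl h2, Finset.sum_ite_mem,
          Finset.inter_eq_right.2 (Finset.filter_subset _ _), sum_single_eq, h0,
          single_eq_zero]) j0 hj0
    rw [if_pos hj00, Subtype.ext_iff] at h1
    exact single_ne_zero (leadingCoeff_ne_zero.2 (coe_ne_zero_iff.2 (hane j0 hj00))) h1
  refine ⟨J₀, Finset.filter_subset _ _, ⟨j0, hj00⟩, (m j0).order,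
    fun j hj => ⟨hane j hj, horder j hj⟩, hβ, fun d hd => ?_⟩
  have hv : v (φ (single (m j0).order (∑ j ∈ J₀, (a j).1.leadingCoeff * b j))) =
      v (φ (m j0)) := by
    rw [hφ.eq_iff, orderTop_single hβ, order_eq_orderTop_of_ne_zero (hne j0 hj00)]
  have hlt : v (∑ j ∈ J, φ (a j) * d j -
      φ (single (m j0).order (∑ j ∈ J₀, (a j).1.leadingCoeff * b j))) < v (φ (m j0)) := by
    have : ∑ j ∈ J, φ (a j) * d j -
        φ (single (m j0).order (∑ j ∈ J₀, (a j).1.leadingCoeff * b j)) =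
        ∑ j ∈ J, (φ (a j) * d j - if j ∈ J₀ then
          φ (single (a j).1.order (a j).1.leadingCoeff * single (g j) (b j)) else 0) := by
      rw [Finset.sum_sub_distrib, Finset.sum_ite_mem,
        Finset.inter_eq_right.2 (Finset.filter_subset _ _), ← map_sum,
        Finset.sum_congr rfl hterm, sum_single_eq]
    rw [this]
    refine Valuation.map_sum_lt v ((Valuation.ne_zero_iff _).2
      ((_root_.map_ne_zero φ).2 (hne j0 hj00))) fun j hj => ?_
    have hlj : LeadEq v (φ (m j)) (φ (a j) * d j) := by
      rw [hm, map_mul]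
      exact (LeadEq.refl _).mul (hd j hj)
    split_ifs with h
    · have h1 : LeadEq v (φ (a j) * d j)
          (φ (single (a j).1.order (a j).1.leadingCoeff * single (g j) (b j))) := by
        refine hlj.symm.trans (hφ.leadEq_iff.2 ?_)
        exact (leadEq_single _).mul (.refl _)
      have h2 : v (φ (a j) * d j) = v (φ (m j0)) := by
        rw [← hlj.map_eq, hφ.eq_iff]
        exact hahnVal_eq.1 (hJ0 j h).2
      rcases h1 with h1 | h1
      · rw [h1, sub_self, map_zero, zero_lt_iff, Valuation.ne_zero_iff]
        exact (_root_.map_ne_zero φ).2 (hne j0 hj00)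
      · exact h2 ▸ h1
    · rw [sub_zero, ← hlj.map_eq]
      refine lt_of_le_of_ne ((hφ _ _).1 (hmax j hj)) fun h' => h ?_
      exact Finset.mem_filter.2 ⟨hj, hahnVal_eq.2 (hφ.eq_iff.1 h')⟩
  right
  rw [Valuation.map_sub_swap, hv]
  exact hlt

end

section Extension

variable {K : Subfield (HahnSeries G k)}
  (hmon : ∀ a ∈ residueField K, ∀ g ∈ valueGroup K, single g a ∈ K)

/-- Elements with distinct values modulo the value group are linearly independent. -/
theorem finite_quotient_of_finiteDimensional (L : IntermediateField K (HahnSeries G k))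
    [FiniteDimensional K L] {Γ : AddSubgroup G} (hΓ : Γ ≤ valueGroup L.toSubfield) :
    Finite (Γ ⧸ (valueGroup K).addSubgroupOf Γ) := by
  classical
  have hy : ∀ q : Γ ⧸ (valueGroup K).addSubgroupOf Γ, ∃ y : L, y.1 ≠ 0 ∧
      y.1.order = (q.out : G) := by
    intro q
    obtain ⟨y, hyL, hy0, hy⟩ := hΓ q.out.2
    exact ⟨⟨y, hyL⟩, hy0, hy⟩
  choose y hy0 hyo using hy
  refine LinearIndependent.finite (R := K) (f := y) ?_
  rw [linearIndependent_iff']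
  intro s a hsum
  by_contra! H
  obtain ⟨q1, hq1, ha1⟩ := H
  have hsum' : ∑ q ∈ s, (a q : HahnSeries G k) * (y q : HahnSeries G k) = 0 := by
    have := congrArg (L.val : L →+* HahnSeries G k) hsum
    rw [map_sum, map_zero] at this
    exact this
  set v := hahnVal k G
  obtain ⟨q0, hq0, hmax⟩ := Finset.exists_max_image s
    (fun q => v ((a q : HahnSeries G k) * (y q : HahnSeries G k))) ⟨q1, hq1⟩
  have hpos : v ((a q0 : HahnSeries G k) * (y q0 : HahnSeries G k)) ≠ 0 := by
    refine (lt_of_lt_of_le ?_ (hmax q1 hq1)).ne'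
    rw [zero_lt_iff, Valuation.ne_zero_iff]
    exact mul_ne_zero (coe_ne_zero_iff.2 ha1) (hy0 q1)
  -- Equal values would place q and q0 in the same coset of vK, so the largest value is attained
  -- once and the sum cannot vanish.
  have hne : ∀ q ∈ s, q ≠ q0 → v ((a q : HahnSeries G k) * (y q : HahnSeries G k)) ≠
      v ((a q0 : HahnSeries G k) * (y q0 : HahnSeries G k)) := by
    intro q hq hqq h
    have hne0 : (a q0 : HahnSeries G k) * (y q0 : HahnSeries G k) ≠ 0 :=
      (Valuation.ne_zero_iff _).1 hpos
    have hne1 : (a q : HahnSeries G k) * (y q : HahnSeries G k) ≠ 0 :=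
      (Valuation.ne_zero_iff v).1 (h ▸ hpos)
    have h1 := hahnVal_eq.1 h
    rw [← order_eq_orderTop_of_ne_zero hne0, ← order_eq_orderTop_of_ne_zero hne1,
      WithTop.coe_inj, order_mul (left_ne_zero_of_mul hne0) (hy0 q0),
      order_mul (left_ne_zero_of_mul hne1) (hy0 q), hyo, hyo] at h1
    refine hqq ?_
    rw [← q.out_eq', ← q0.out_eq']
    refine QuotientAddGroup.eq.2 ?_
    rw [AddSubgroup.mem_addSubgroupOf]
    have h2 : ((-q.out + q0.out : Γ) : G) = (a q : HahnSeries G k).order -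
        (a q0 : HahnSeries G k).order := by
      rw [AddSubgroup.coe_add, AddSubgroup.coe_neg]
      have := eq_sub_of_add_eq' h1
      rw [this]; abel
    rw [h2]
    exact sub_mem ⟨_, (a q).2, left_ne_zero_of_mul hne1, rfl⟩
      ⟨_, (a q0).2, left_ne_zero_of_mul hne0, rfl⟩
  rw [← Finset.add_sum_erase _ _ hq0] at hsum'
  have hlt := Valuation.map_sum_lt v (s := s.erase q0)
    (f := fun q => (a q : HahnSeries G k) * (y q : HahnSeries G k)) hpos fun q hq =>
      lt_of_le_of_ne (hmax q (Finset.mem_of_mem_erase hq))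
        (hne q (Finset.mem_of_mem_erase hq) (Finset.ne_of_mem_erase hq))
  rw [eq_neg_of_add_eq_zero_left hsum', Valuation.map_neg] at hlt
  exact lt_irrefl _ hlt

include hmon in
/-- The constants of a finite extension are a finite extension of the residue field. -/
theorem finiteDimensional_constants (L : IntermediateField K (HahnSeries G k))
    [FiniteDimensional K L] (D : IntermediateField (residueField K) k)
    (hD : ∀ a ∈ D, HahnSeries.C a ∈ L) : FiniteDimensional (residueField K) D := by
  classical
  let B := Module.Basis.ofVectorSpace (residueField K) D
  have hli := B.linearIndependent
  have : LinearIndependent K fun i => (⟨HahnSeries.C (B i : k), hD _ (B i).2⟩ : L) := by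
    rw [linearIndependent_iff']
    intro s a hsum
    by_contra! H
    obtain ⟨i1, hi1, ha1⟩ := H
    have hsum' : ∑ i ∈ s, (a i : HahnSeries G k) * HahnSeries.C (B i : k) = 0 := by
      have := congrArg (L.val : L →+* HahnSeries G k) hsum
      rw [map_sum, map_zero] at this
      exact this
    obtain ⟨i0, hi0, hmax⟩ := Finset.exists_max_image s
      (fun i => hahnVal k G (a i : HahnSeries G k)) ⟨i1, hi1⟩
    have hne0 : (a i0 : HahnSeries G k) ≠ 0 := by
      rw [← Valuation.ne_zero_iff (hahnVal k G)]
      refine (lt_of_lt_of_le ?_ (hmax i1 hi1)).ne'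
      rw [zero_lt_iff, Valuation.ne_zero_iff]
      exact coe_ne_zero_iff.2 ha1
    set δ := (a i0 : HahnSeries G k).order with hδ
    have hδK : δ ∈ valueGroup K := ⟨_, (a i0).2, hne0, rfl⟩
    -- At the least order δ, which lies in vK, the coefficients belong to Kv; comparing coefficients
    -- there turns a relation over K into one over Kv.
    have hcoeff : ∀ i ∈ s, (a i : HahnSeries G k).coeff δ ∈ residueField K := fun i hi =>
      coeff_mem_residueField hmon (a i).2 hδK (by
        rw [hδ, order_eq_orderTop_of_ne_zero hne0]
        exact hmax i hi)
    have h1 := congrArg (fun x : HahnSeries G k => x.coeff δ) hsum'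
    simp only [HahnSeries.coeff_sum, HahnSeries.coeff_zero, mul_comm _ (HahnSeries.C _),
      HahnSeries.C_mul_eq_smul, HahnSeries.coeff_smul, smul_eq_mul] at h1
    have h2 := linearIndependent_iff'.1 hli s (fun i => if h : i ∈ s then
      ⟨(a i : HahnSeries G k).coeff δ, hcoeff i h⟩ else 0) (by
        refine Subtype.ext ?_
        rw [AddSubmonoidClass.coe_finsetSum]
        rw [ZeroMemClass.coe_zero, ← h1]
        refine Finset.sum_congr rfl fun i hi => ?_
        rw [dif_pos hi, mul_comm]
        rfl) i0 hi0
    rw [dif_pos hi0, Subtype.ext_iff] at h2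
    exact hne0 (coeff_order_eq_zero.1 h2)
  have := this.finite
  exact Module.Finite.of_basis B

end Extension

end PowerSeriesField

/-! ### The field generated by the monomials -/

namespace PowerSeriesField

open ValuedField

variable {k G : Type*} [Field k] [AddCommGroup G] [LinearOrder G] [IsOrderedAddMonoid G]
  {K : Subfield (HahnSeries G k)} {c : ℕ → k} {γ : ℕ → G}

section

variable (K c γ)

/-- The field `K(c_i t^{γ_i} | i ∈ ℕ)`. -/
noncomputable def monomialField : IntermediateField K (HahnSeries G k) :=
  IntermediateField.adjoin K (Set.range fun i => single (γ i) (c i))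

/-- The group generated by `vK` and the exponents `γ_i` with `c_i ≠ 0`. -/
noncomputable def exponentGroup : AddSubgroup G :=
  valueGroup K ⊔ AddSubgroup.closure {g | ∃ i, c i ≠ 0 ∧ γ i = g}

/-- The field `Kv(c_i | i ∈ ℕ)`. -/
noncomputable def constantField : IntermediateField (residueField K) k :=
  IntermediateField.adjoin (residueField K) (Set.range c)

end

theorem single_mem_monomialField (i : ℕ) : single (γ i) (c i) ∈ monomialField K c γ :=
  IntermediateField.subset_adjoin _ _ ⟨i, rfl⟩

theorem partialSum_mem_monomialField (n : ℕ) : partialSum c γ n ∈ monomialField K c γ :=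
  sum_mem fun _ _ => single_mem_monomialField _

theorem le_valueGroup_monomialField : valueGroup K ≤ valueGroup (monomialField K c γ).toSubfield := by
  rintro _ ⟨x, hx, hx0, rfl⟩
  exact ⟨x, (monomialField K c γ).algebraMap_mem ⟨x, hx⟩, hx0, rfl⟩

theorem exponentGroup_le : exponentGroup K c γ ≤ valueGroup (monomialField K c γ).toSubfield := by
  refine sup_le le_valueGroup_monomialField ((AddSubgroup.closure_le _).2 ?_)
  rintro _ ⟨i, hi, rfl⟩
  exact ⟨_, single_mem_monomialField i, single_ne_zero hi, order_single hi⟩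

theorem closure_monomials {s : HahnSeries G k}
    (hs : s ∈ Submonoid.closure (Set.range fun i => single (γ i) (c i))) :
    ∃ g ∈ exponentGroup K c γ, ∃ b ∈ constantField K c, s = single g b := by
  induction hs using Submonoid.closure_induction with
  | mem x hx =>
    obtain ⟨i, rfl⟩ := hx
    by_cases hc : c i = 0
    -- A zero monomial is rewritten with exponent 0, because γ i then need not belong to
    -- `exponentGroup`.
    · exact ⟨0, zero_mem _, 0, zero_mem _, by simp [hc]⟩
    · exact ⟨γ i, (le_sup_right : _ ≤ exponentGroup K c γ) (AddSubgroup.subset_closure ⟨i, hc, rfl⟩),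
        c i, IntermediateField.subset_adjoin _ _ ⟨i, rfl⟩, rfl⟩
  | one => exact ⟨0, zero_mem _, 1, one_mem _, rfl⟩
  | mul x y _ _ hx hy =>
    obtain ⟨g, hg, b, hb, rfl⟩ := hx
    obtain ⟨g', hg', b', hb', rfl⟩ := hy
    exact ⟨g + g', add_mem hg hg', b * b', mul_mem hb hb', single_mul_single⟩

section

variable (hmon : ∀ a ∈ residueField K, ∀ g ∈ valueGroup K, single g a ∈ K)
  (hsep : ∀ i, IsSeparable (residueField K) (c i))
  (htame : ∀ i, ∃ e : ℕ, 0 < e ∧ e.Coprime (ringExpChar (residueField K)) ∧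
    e • γ i ∈ valueGroup K)
include hmon hsep htame

theorem isSeparable_monomialField : Algebra.IsSeparable K (monomialField K c γ) := by
  rw [monomialField, IntermediateField.isSeparable_adjoin_iff_isSeparable]
  rintro _ ⟨i, rfl⟩
  exact isSeparable_single hmon (hsep i) (htame i)

/-- The field generated by the monomials has a basis of products of these monomials. -/
theorem exists_monomial_basis :
    ∃ B ⊆ (Submonoid.closure (Set.range fun i => single (γ i) (c i)) : Set (HahnSeries G k)),
      LinearIndependent K ((↑) : B → HahnSeries G k) ∧
      Submodule.span K B = Subalgebra.toSubmodule (monomialField K c γ).toSubalgebra := by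
  obtain ⟨B, hB, hspan, hli⟩ := exists_linearIndependent K
    (Submonoid.closure (Set.range fun i => single (γ i) (c i)) : Set (HahnSeries G k))
  refine ⟨B, hB, hli, ?_⟩
  -- The generators are algebraic, so the field is the algebra they generate, that is, the span of
  -- their products.
  rw [hspan, monomialField, IntermediateField.adjoin_toSubalgebra_of_isAlgebraic,
    Algebra.adjoin_eq_span]
  rintro _ ⟨i, rfl⟩
  exact (isSeparable_single hmon (hsep i) (htame i)).isIntegral.isAlgebraic

/-- The leading monomials of the elements of the field generated by the monomials. -/
theorem lead_mem_of_mem_monomialField {y : HahnSeries G k} (hy : y ∈ monomialField K c γ)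
    (hy0 : y ≠ 0) : y.order ∈ exponentGroup K c γ ∧ y.leadingCoeff ∈ constantField K c := by
  obtain ⟨B, hB, hli, hspan⟩ := exists_monomial_basis hmon hsep htame
  have hyB : y ∈ Submodule.span K (Set.range ((↑) : B → HahnSeries G k)) := by
    rw [Subtype.range_coe, hspan]; exact hy
  rw [Finsupp.mem_span_range_iff_exists_finsupp] at hyB
  obtain ⟨a, rfl⟩ := hyB
  choose g hg b hb hs using fun s : B => closure_monomials (K := K) (hB s.2)
  obtain ⟨J₀, hJ₀, ⟨j, hj⟩, δ, hδ, hβ, hlead⟩ := exists_lead_monomial hmon isValuedEmbedding_id a.support g b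
    (fun a h => linearIndependent_iff'.1 hli _ a (by
      rw [← h]
      exact Finset.sum_congr rfl fun j _ => by rw [← hs]; rfl)) a (by
    by_contra! h
    exact hy0 (Finset.sum_eq_zero fun j hj => by
      change a j • (j : HahnSeries G k) = 0
      rw [h j hj, zero_smul]))
  have h := hlead (fun s => s) fun j _ => by rw [← hs]; exact .refl _
  change LeadEq _ (single _ _) (a.sum fun s r => r • (s : HahnSeries G k)) at h
  have ho := LeadEq.order_eq h
  have hδm : δ ∈ exponentGroup K c γ := by
    rw [← (hδ j hj).2]
    exact add_mem ((le_sup_left : _ ≤ exponentGroup K c γ)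
      ⟨_, (a j).2, coe_ne_zero_iff.2 (hδ j hj).1, rfl⟩) (hg j)
  have hβm : ∑ j ∈ J₀, (a j).1.leadingCoeff * b j ∈ constantField K c := by
    refine sum_mem fun j _ => mul_mem ?_ (hb j)
    exact (constantField K c).algebraMap_mem ⟨_, leadingCoeff_mem_residueField hmon (a j).2⟩
  rw [order_single hβ] at ho
  refine ⟨ho ▸ hδm, ?_⟩
  rw [leadingCoeff_eq, ← ho]
  have : (a.sum fun s r => r • (s : HahnSeries G k)).coeff δ =
      ∑ j ∈ J₀, (a j).1.leadingCoeff * b j := by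
    rcases h with h | h
    · rw [← h, coeff_single_same]
    · rw [hahnVal_lt, orderTop_single hβ] at h
      have := coeff_eq_zero_of_lt_orderTop h
      rw [HahnSeries.coeff_sub, coeff_single_same, sub_eq_zero] at this
      exact this.symm
  rw [this]
  exact hβm

/-- An algebraic pseudo-limit of the partial sums forces the monomials to generate a finite
extension. -/
theorem finiteDimensional_monomialField (hγ : StrictMono γ) {W Γ₀ : Type*} [Field W]
    [IsAlgClosed W] [LinearOrderedCommGroupWithZero Γ₀] {v : Valuation W Γ₀}
    {φ : HahnSeries G k →+* W} (hφ : IsValuedEmbedding v φ) {r : W}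
    (hr : IsAlgebraic (K.map φ) r)
    (h : ∀ n, v (r - φ (partialSum c γ n)) ≤ v (φ (single (γ n) 1))) :
    FiniteDimensional K (monomialField K c γ) := by
  obtain ⟨B, hB, hli, hspan⟩ := exists_monomial_basis hmon hsep htame
  choose g hg b hb hs using fun s : B => closure_monomials (K := K) (hB s.2)
  let F := IntermediateField.adjoin (K.map φ) {r}
  have : FiniteDimensional (K.map φ) F := IntermediateField.adjoin.finiteDimensional hr.isIntegral
  obtain ⟨H, hFH, -, hH, him⟩ := exists_hensel_immediate (hensel_top (v := v)) (le_top : F.toSubfield ≤ ⊤)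
  have hKF : ∀ x ∈ K, φ x ∈ F := fun x hx => F.algebraMap_mem ⟨φ x, x, hx, rfl⟩
  have hmH := single_mem_of_pseudo_limit hmon hsep htame hγ hφ hH (fun x hx => hFH (hKF x hx))
    (hFH (IntermediateField.mem_adjoin_simple_self _ r)) h
  have hSH : Submonoid.closure (Set.range fun i => single (γ i) (c i)) ≤
      H.toSubmonoid.comap (φ : HahnSeries G k →* W) := by
    rw [Submonoid.closure_le]
    rintro _ ⟨i, rfl⟩
    exact hmH i
  -- Every basis monomial lies in H, which is immediate over K(r), so its leading term occurs in
  -- K(r). These representatives stay independent over K, so [K(r):K] bounds the size of B.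
  choose d hd hlead using fun s : B => him _ (hSH (hB s.2))
  have hdli : LinearIndependent (K.map φ) fun s : B => (⟨d s, hd s⟩ : F) := by
    rw [linearIndependent_iff']
    intro J a' hsum
    by_contra! H
    obtain ⟨j1, hj1, ha1⟩ := H
    choose a ha ha' using fun s => (a' s).2
    have hsum' : ∑ s ∈ J, φ (a s) * d s = 0 := by
      have := congrArg (F.val : F →+* W) hsum
      rw [map_sum, map_zero] at this
      rw [← this]
      refine Finset.sum_congr rfl fun s _ => ?_
      erw [ha']
      rfl
    obtain ⟨J₀, -, -, δ, -, hβ, hl⟩ := exists_lead_monomial hmon hφ J g b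
      (fun a h => linearIndependent_iff'.1 hli _ a (by
        rw [← h]
        exact Finset.sum_congr rfl fun j _ => by rw [← hs]; rfl)) (fun s => ⟨a s, ha s⟩) (by
      refine ⟨j1, hj1, fun h0 => ha1 (Subtype.ext ?_)⟩
      have h1 : a j1 = 0 := congrArg Subtype.val h0
      rw [← ha', h1, ZeroMemClass.coe_zero]
      exact map_zero φ)
    have := hl d fun s _ => by rw [← hs]; exact hlead s
    rw [hsum'] at this
    exact (_root_.map_ne_zero φ).2 (single_ne_zero hβ) (this.eq_zero_iff.2 rfl)
  have hfin : Finite B := hdli.finite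
  have : FiniteDimensional K (Submodule.span K B) := FiniteDimensional.span_of_finite K B.toFinite
  rw [hspan] at this
  exact this

end

/-- If the monomials generate a finite extension, then so do their coefficients. -/
theorem finiteDimensional_constantField
    (hmon : ∀ a ∈ residueField K, ∀ g ∈ valueGroup K, single g a ∈ K)
    (hsep : ∀ i, IsSeparable (residueField K) (c i))
    [FiniteDimensional K (monomialField K c γ)] :
    FiniteDimensional (residueField K) (constantField K c) := by
  set L := monomialField K c γ
  have hfin := finite_quotient_of_finiteDimensional L (exponentGroup_le (K := K) (c := c) (γ := γ))
  let D : IntermediateField (residueField K) k :=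
    { L.toSubfield.comap (HahnSeries.C : k →+* HahnSeries G k) with
      algebraMap_mem' := fun a => L.algebraMap_mem ⟨_, hmon a a.2 0 (zero_mem _)⟩ }
  have hD : ∀ a, a ∈ D ↔ HahnSeries.C a ∈ L := fun _ => Iff.rfl
  have := finiteDimensional_constants hmon L D fun a ha => (hD a).1 ha
  have hγm : ∀ i : {i // c i ≠ 0}, γ i ∈ exponentGroup K c γ := fun i =>
    (le_sup_right : _ ≤ exponentGroup K c γ) (AddSubgroup.subset_closure ⟨i, i.2, rfl⟩)
  let q : {i // c i ≠ 0} → exponentGroup K c γ ⧸ (valueGroup K).addSubgroupOf (exponentGroup K c γ) :=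
    fun i => QuotientAddGroup.mk ⟨γ i, hγm i⟩
  -- c i need not lie in L, but if γ i and γ j differ by an element of vK then c i / c j does. Hence
  -- the constants D of L together with one coefficient per coset generate everything, and there are
  -- finitely many cosets.
  let ρ := Set.rangeSplitting q
  have hρ : Finite (Set.range ρ) := (Set.finite_range ρ).to_subtype
  let A := IntermediateField.adjoin (residueField K) ((fun i : {i // c i ≠ 0} => c i) '' Set.range ρ)
  have : FiniteDimensional (residueField K) A := by
    have : Finite ((fun i : {i // c i ≠ 0} => c i) '' Set.range ρ) :=
      ((Set.finite_range ρ).image _).to_subtype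
    refine IntermediateField.finiteDimensional_adjoin ?_
    rintro _ ⟨i, -, rfl⟩
    exact (hsep i).isIntegral
  have hle : constantField K c ≤ D ⊔ A := by
    rw [constantField, IntermediateField.adjoin_le_iff]
    rintro _ ⟨i, rfl⟩
    by_cases hi : c i = 0
    · rw [hi]; exact zero_mem _
    set j := ρ ⟨q ⟨i, hi⟩, ⟨i, hi⟩, rfl⟩ with hj
    have hq : q j = q ⟨i, hi⟩ := Set.apply_rangeSplitting q _
    have hsub : -γ j + γ i ∈ valueGroup K := by
      have := QuotientAddGroup.eq.1 hq
      rwa [AddSubgroup.mem_addSubgroupOf] at this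
    have hdiv : c i / c j ∈ D := by
      rw [hD]
      have h1 : (HahnSeries.C (c i / c j) : HahnSeries G k) =
          single (γ i) (c i) * (single (γ j) (c j))⁻¹ * single (-(-γ j + γ i)) 1 := by
        have hne : (single (γ j) (c j) : HahnSeries G k) ≠ 0 := single_ne_zero j.2
        rw [mul_right_comm, eq_mul_inv_iff_mul_eq₀ hne, HahnSeries.C_apply, single_mul_single,
          single_mul_single, div_mul_cancel₀ _ j.2]
        congr 1
        · rw [neg_add_rev, neg_neg, zero_add, add_neg_cancel_left]
        · rw [mul_one]
      rw [h1]
      refine mul_mem (mul_mem (single_mem_monomialField i) (inv_mem (single_mem_monomialField j))) ?_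
      exact L.algebraMap_mem ⟨_, hmon 1 (one_mem _) _ (neg_mem hsub)⟩
    have : c i = c i / c j * c j := (div_mul_cancel₀ _ j.2).symm
    rw [this]
    exact mul_mem ((le_sup_left : D ≤ D ⊔ A) hdiv)
      ((le_sup_right : A ≤ D ⊔ A) (IntermediateField.subset_adjoin _ _ ⟨j, ⟨_, rfl⟩, rfl⟩))
  have := IntermediateField.finiteDimensional_sup D A
  exact Submodule.finiteDimensional_of_le (S₁ := Subalgebra.toSubmodule (constantField K c).toSubalgebra)
    (S₂ := Subalgebra.toSubmodule (D ⊔ A).toSubalgebra) hle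

end PowerSeriesField

/-! ### Separating the series from algebraic elements -/

namespace PowerSeriesField

open Polynomial ValuedField Filter

variable {k G : Type*} [Field k] [AddCommGroup G] [LinearOrder G] [IsOrderedAddMonoid G]

/-- The canonical valuation extends to the algebraic closure. -/
theorem exists_valuedEmbedding_algebraicClosure :
    ∃ O : ValuationSubring (AlgebraicClosure (HahnSeries G k)),
      IsValuedEmbedding O.valuation
        (algebraMap (HahnSeries G k) (AlgebraicClosure (HahnSeries G k))) := by
  set φ := algebraMap (HahnSeries G k) (AlgebraicClosure (HahnSeries G k))
  set R := (hahnVal k G).valuationSubring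
  obtain ⟨O, hO, hloc⟩ := IsLocalRing.exists_factor_valuationRing (φ.comp R.subtype)
  refine ⟨O, ?_⟩
  have key : ∀ x, hahnVal k G x ≤ 1 ↔ O.valuation (φ x) ≤ 1 := by
    intro x
    rw [O.valuation_le_one_iff]
    refine ⟨fun hx => hO ⟨x, hx⟩, fun hx => ?_⟩
    by_contra! h
    have hx0 : x ≠ 0 := by
      rintro rfl
      simp at h
    have hinv : hahnVal k G x⁻¹ < 1 := by
      rw [map_inv₀]
      exact inv_lt_one_of_one_lt₀ h
    have hu : IsUnit (⟨x⁻¹, hinv.le⟩ : R) := by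
      refine hloc.map_nonunit _ ?_
      refine IsUnit.of_mul_eq_one (⟨φ x, hx⟩ : O) (Subtype.ext ?_)
      change φ x⁻¹ * φ x = 1
      rw [← map_mul, inv_mul_cancel₀ hx0, map_one]
    obtain ⟨y, hy⟩ := hu.exists_right_inv
    have hy' : x⁻¹ * y = 1 := congrArg Subtype.val hy
    have hyx : (y : HahnSeries G k) = x := by
      rw [inv_mul_eq_one₀ hx0] at hy'
      exact hy'.symm
    exact absurd y.2 (by rw [hyx]; exact not_le.2 h)
  intro x y
  by_cases hy : y = 0
  · simp [hy]
  have h1 : hahnVal k G y ≠ 0 := (Valuation.ne_zero_iff _).2 hy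
  have h2 : O.valuation (φ y) ≠ 0 := (Valuation.ne_zero_iff _).2 ((_root_.map_ne_zero φ).2 hy)
  have := key (x / y)
  rwa [map_div₀, map_div₀, map_div₀, div_le_one₀ (zero_lt_iff.2 h1),
    div_le_one₀ (zero_lt_iff.2 h2)] at this

/-- The restriction of an embedding to a subfield. -/
def restrictHom {N W : Type*} [Field N] [Field W] (φ : N →+* W) (K : Subfield N) : K →+* K.map φ :=
  (φ.comp K.subtype).codRestrict (K.map φ) fun x => ⟨x, x.2, rfl⟩

theorem isAlgebraic_map {N W : Type*} [Field N] [Field W] (φ : N →+* W) {K : Subfield N} {x : N}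
    (hx : IsAlgebraic K x) : IsAlgebraic (K.map φ) (φ x) :=
  hx.ringHom_of_comp_eq (restrictHom φ K) φ (restrictHom φ K).injective rfl

theorem isSeparable_map {N W : Type*} [Field N] [Field W] (φ : N →+* W) {K : Subfield N} {x : N}
    (hx : IsSeparable K x) : IsSeparable (K.map φ) (φ x) := by
  have h : ∀ p : K[X], aeval (φ x) (p.map (restrictHom φ K)) = φ (aeval x p) := by
    intro p
    rw [aeval_def, eval₂_map, aeval_def, hom_eval₂]
    rfl
  refine isSeparable_of_simple_root (F := (minpoly K x).map (restrictHom φ K)) ?_ ?_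
  · rw [h, minpoly.aeval, map_zero]
  · rw [derivative_map, h]
    exact (_root_.map_ne_zero φ).2 (hx.aeval_derivative_ne_zero (minpoly.aeval K x))

section

variable {K : Subfield (HahnSeries G k)} {c : ℕ → k} {γ : ℕ → G}
  (hmon : ∀ a ∈ residueField K, ∀ g ∈ valueGroup K, single g a ∈ K)
  (hsep : ∀ i, IsSeparable (residueField K) (c i))
  (htame : ∀ i, ∃ e : ℕ, 0 < e ∧ e.Coprime (ringExpChar (residueField K)) ∧
    e • γ i ∈ valueGroup K)
include hmon hsep htame

/-- The monomials are separable over K, and `Hensel.of_separable` applies after embedding into the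
algebraic closure, where roots are available. -/
theorem hensel_monomialField (hK : Hensel (hahnVal k G) K) :
    Hensel (hahnVal k G) (monomialField K c γ).toSubfield := by
  obtain ⟨O, hφ⟩ := exists_valuedEmbedding_algebraicClosure (k := k) (G := G)
  have := isSeparable_monomialField hmon hsep htame
  rw [← hensel_map_iff _ hφ] at hK ⊢
  refine hK.of_separable ?_ ?_
  · rintro _ ⟨x, hx, rfl⟩
    exact ⟨x, (monomialField K c γ).algebraMap_mem ⟨x, hx⟩, rfl⟩
  · rintro _ ⟨x, hx, rfl⟩
    refine isSeparable_map _ ?_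
    have h1 := Algebra.IsSeparable.isSeparable K (⟨x, hx⟩ : monomialField K c γ)
    rwa [IsSeparable, ← minpoly.algebraMap_eq (B' := HahnSeries G k)
      (algebraMap (monomialField K c γ) (HahnSeries G k)).injective] at h1

theorem isAlgebraic_of_mem_monomialField {x : HahnSeries G k}
    (hx : x ∈ monomialField K c γ) : IsAlgebraic K x := by
  have := isSeparable_monomialField hmon hsep htame
  have h1 := Algebra.IsAlgebraic.isAlgebraic (R := K) (⟨x, hx⟩ : monomialField K c γ)
  exact h1.algebraMap (A := HahnSeries G k)

section Embedding

variable (hγ : StrictMono γ) (hinf : ¬ FiniteDimensional K (monomialField K c γ))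
  {W Γ₀ : Type*} [Field W] [IsAlgClosed W] [LinearOrderedCommGroupWithZero Γ₀] {v : Valuation W Γ₀}
  {φ : HahnSeries G k →+* W} (hφ : IsValuedEmbedding v φ)
include hinf hφ

/-- The partial sums are eventually as close to the series as needed to separate it from an
algebraic element. -/
theorem eventually_leadEq_of_isAlgebraic {r : W} (hr : IsAlgebraic (K.map φ) r) :
    ∀ᶠ m in atTop, LeadEq v (φ (powerSeries c γ hγ) - r) (φ (partialSum c γ m) - r) := by
  -- r is not a pseudo-limit, so from some n on the partial sums are closer to the series than r is.
  have hex : ∃ n, v (φ (single (γ n) 1)) < v (r - φ (partialSum c γ n)) := by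
    by_contra! h
    exact hinf (finiteDimensional_monomialField hmon hsep htame hγ hφ hr h)
  obtain ⟨n, hn⟩ := hex
  have hsum : ∀ m, n ≤ m →
      v (φ (powerSeries c γ hγ) - φ (partialSum c γ m)) < v (r - φ (partialSum c γ n)) := by
    intro m hm
    refine lt_of_le_of_lt ?_ hn
    rw [← map_sub, hφ.le_iff, orderTop_single one_ne_zero]
    exact (WithTop.coe_le_coe.2 (hγ.monotone hm)).trans (le_orderTop_sub_partialSum hγ m)
  have hz : v (φ (powerSeries c γ hγ) - r) = v (r - φ (partialSum c γ n)) := by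
    rw [Valuation.map_sub_swap v r (φ _), ← Valuation.map_add_eq_of_lt_right v (x :=
      φ (powerSeries c γ hγ) - φ (partialSum c γ n)) (y := φ (partialSum c γ n) - r)
      (by rw [Valuation.map_sub_swap v _ r]; exact hsum n le_rfl)]
    congr 1
    ring
  filter_upwards [eventually_ge_atTop n] with m hm
  right
  rw [sub_sub_sub_cancel_right, hz]
  exact hsum m hm

/-- Over W the polynomial splits, its roots are algebraic over K because its coefficients are, and
leading terms multiply. This is the input of `exists_hensel_specialization`. -/
theorem eventually_leadEq_eval {L : Subfield (HahnSeries G k)} (hL : ∀ x ∈ L, IsAlgebraic K x)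
    (g : L[X]) : ∀ᶠ m in atTop, LeadEq (hahnVal k G)
      ((g.map L.subtype).eval (powerSeries c γ hγ)) ((g.map L.subtype).eval (partialSum c γ m)) := by
  by_cases hg : g = 0
  · simp [hg, LeadEq.refl]
  let M := algebraicClosure (K.map φ) W
  let ψ : L →+* M := (φ.comp L.subtype).codRestrict M fun x =>
    mem_algebraicClosure_iff.2 (isAlgebraic_map φ
      (hL x x.2))
  have hroot : ∀ r ∈ (g.map (φ.comp L.subtype)).roots, IsAlgebraic (K.map φ) r := by
    intro r hr
    have h1 : IsAlgebraic M r := by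
      refine ⟨g.map ψ, (Polynomial.map_ne_zero_iff ψ.injective).2 hg, ?_⟩
      rw [aeval_def, eval₂_map]
      have := isRoot_of_mem_roots hr
      rwa [IsRoot, eval_map] at this
    exact h1.restrictScalars (K.map φ)
  have hprod : ∀ s : Multiset W, (∀ r ∈ s, IsAlgebraic (K.map φ) r) → ∀ᶠ m in atTop,
      LeadEq v (s.map fun r => φ (powerSeries c γ hγ) - r).prod
        (s.map fun r => φ (partialSum c γ m) - r).prod := by
    intro s
    induction s using Multiset.induction with
    | empty => intro _; simp [LeadEq.refl]
    | cons a s ih =>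
      intro hs
      filter_upwards [eventually_leadEq_of_isAlgebraic hmon hsep htame hγ hinf hφ
        (hs a (Multiset.mem_cons_self a s)), ih fun r hr => hs r (Multiset.mem_cons_of_mem hr)]
        with m h1 h2
      rw [Multiset.map_cons, Multiset.prod_cons, Multiset.map_cons, Multiset.prod_cons]
      exact h1.mul h2
  have heval : ∀ x, φ ((g.map L.subtype).eval x) = (g.map (φ.comp L.subtype)).leadingCoeff *
      ((g.map (φ.comp L.subtype)).roots.map fun r => φ x - r).prod := by
    intro x
    rw [← eval_map_apply, Polynomial.map_map]
    conv_lhs => rw [(IsAlgClosed.splits (g.map (φ.comp L.subtype))).eq_prod_roots]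
    rw [eval_mul, eval_C, eval_multiset_prod, Multiset.map_map]
    simp
  filter_upwards [hprod _ hroot] with m hm
  rw [← hφ.leadEq_iff, heval, heval]
  exact (LeadEq.refl _).mul hm

end Embedding

/-- The series is itself a pseudo-limit of its partial sums, so it cannot be algebraic. -/
theorem transcendental_powerSeries (hγ : StrictMono γ)
    (hinf : ¬ FiniteDimensional K (monomialField K c γ)) :
    Transcendental K (powerSeries c γ hγ) := by
  obtain ⟨O, hφ⟩ := exists_valuedEmbedding_algebraicClosure (k := k) (G := G)
  intro halg
  refine hinf (finiteDimensional_monomialField hmon hsep htame hγ hφ (isAlgebraic_map _ halg)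
    fun n => ?_)
  rw [← map_sub, hφ.le_iff, orderTop_single one_ne_zero]
  exact le_orderTop_sub_partialSum hγ n

/-- The field generated by the monomials is relatively algebraically closed in a henselian
immediate extension that contains the series. -/
theorem exists_hensel_extension (hK : Hensel (hahnVal k G) K) (hγ : StrictMono γ)
    (hinf : ¬ FiniteDimensional K (monomialField K c γ)) :
    ∃ E, (monomialField K c γ).toSubfield ≤ E ∧ powerSeries c γ hγ ∈ E ∧ Hensel (hahnVal k G) E ∧
      Immediate (hahnVal k G) (monomialField K c γ).toSubfield E ∧
      ∀ a ∈ E, IsAlgebraic (monomialField K c γ).toSubfield a →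
        a ∈ (monomialField K c γ).toSubfield := by
  obtain ⟨O, hφ⟩ := exists_valuedEmbedding_algebraicClosure (k := k) (G := G)
  exact exists_hensel_specialization hensel_hahnVal_top
    (hensel_monomialField hmon hsep htame hK) partialSum_mem_monomialField
    (eventually_leadEq_eval hmon hsep htame hγ hinf hφ fun _ =>
      isAlgebraic_of_mem_monomialField hmon hsep htame)

end

theorem not_finiteDimensional_monomialField {K : Subfield (HahnSeries G k)} {c : ℕ → k} {γ : ℕ → G}
    (hmon : ∀ a ∈ residueField K, ∀ g ∈ valueGroup K, single g a ∈ K)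
    (hsep : ∀ i, IsSeparable (residueField K) (c i))
    (h : Infinite (exponentGroup K c γ ⧸ (valueGroup K).addSubgroupOf (exponentGroup K c γ)) ∨
      ¬ FiniteDimensional (residueField K) (constantField K c)) :
    ¬ FiniteDimensional K (monomialField K c γ) := by
  intro hfin
  rcases h with h | h
  · exact h.not_finite (finite_quotient_of_finiteDimensional _ exponentGroup_le)
  · exact h (finiteDimensional_constantField (γ := γ) hmon hsep)

end PowerSeriesField

/-! ### Value group, residue field and implicit constant field of K(z) -/

namespace PowerSeriesField

open ValuedField

variable {k G : Type*} [Field k] [AddCommGroup G] [LinearOrder G] [IsOrderedAddMonoid G]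

theorem le_adjoin (F : Subfield (HahnSeries G k)) (S : Set (HahnSeries G k)) : F ≤ adjoin F S :=
  fun x hx => (IntermediateField.adjoin F S).algebraMap_mem ⟨x, hx⟩

theorem subset_adjoin (F : Subfield (HahnSeries G k)) (S : Set (HahnSeries G k)) :
    S ⊆ adjoin F S :=
  IntermediateField.subset_adjoin F S

theorem adjoin_le {F E : Subfield (HahnSeries G k)} {S : Set (HahnSeries G k)} (hF : F ≤ E)
    (hS : S ⊆ E) : adjoin F S ≤ E := by
  let E' : IntermediateField F (HahnSeries G k) := { E with algebraMap_mem' := fun a => hF a.2 }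
  exact (IntermediateField.adjoin_le_iff (T := E')).2 hS

theorem valueGroup_mono {F E : Subfield (HahnSeries G k)} (h : F ≤ E) :
    valueGroup F ≤ valueGroup E := by
  rintro _ ⟨x, hx, hx0, rfl⟩
  exact ⟨x, h hx, hx0, rfl⟩

theorem residueField_mono {F E : Subfield (HahnSeries G k)} (h : F ≤ E) :
    residueField F ≤ residueField E := by
  rintro _ ⟨x, hx, rfl⟩
  exact ⟨x, ⟨h hx.1, hx.2⟩, rfl⟩

section

variable {K : Subfield (HahnSeries G k)} {c : ℕ → k} {γ : ℕ → G}
  (hmon : ∀ a ∈ residueField K, ∀ g ∈ valueGroup K, single g a ∈ K)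
  (hsep : ∀ i, IsSeparable (residueField K) (c i))
  (htame : ∀ i, ∃ e : ℕ, 0 < e ∧ e.Coprime (ringExpChar (residueField K)) ∧
    e • γ i ∈ valueGroup K)
  (hγ : StrictMono γ)
include hmon hsep htame

theorem single_mem_henselization (i : ℕ) :
    single (γ i) (c i) ∈ henselization (adjoin K {powerSeries c γ hγ}) := by
  rw [henselization, Subfield.mem_sInf]
  rintro E ⟨hE, hEh⟩
  refine single_mem_of_pseudo_limit hmon hsep htame hγ isValuedEmbedding_id
    (isHenselian_iff.1 hEh) (fun x hx => hE (le_adjoin _ _ hx))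
    (hE (subset_adjoin K {powerSeries c γ hγ} rfl)) (fun n => ?_) i
  refine isValuedEmbedding_id.le_iff.2 ?_
  rw [orderTop_single one_ne_zero]
  exact le_orderTop_sub_partialSum hγ n

theorem monomialField_le_henselization :
    (monomialField K c γ).toSubfield ≤ henselization (adjoin K {powerSeries c γ hγ}) := by
  refine adjoin_le ?_ ?_
  · exact (le_adjoin _ _).trans (le_sInf fun E hE => hE.1)
  · rintro _ ⟨i, rfl⟩
    exact single_mem_henselization hmon hsep htame hγ i

theorem exponent_mem_valueGroup {i : ℕ} (hi : c i ≠ 0) :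
    γ i ∈ valueGroup (adjoin K {powerSeries c γ hγ}) :=
  valueGroup_le_of_immediate (immediate_henselization _)
    ⟨_, single_mem_henselization hmon hsep htame hγ i, single_ne_zero hi, order_single hi⟩

theorem coeff_mem_residueField_of_exponent_mem (i : ℕ) (hi : γ i ∈ valueGroup K) :
    c i ∈ residueField (adjoin K {powerSeries c γ hγ}) := by
  refine residueField_le_of_immediate (immediate_henselization _)
    ⟨single (γ i) (c i) * single (-γ i) 1, ⟨mul_mem (single_mem_henselization hmon hsep htame hγ i)
      ?_, ?_⟩, ?_⟩
  · exact (le_sInf fun E hE => hE.1 : adjoin K {powerSeries c γ hγ} ≤ henselization _)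
      (le_adjoin _ _ (hmon 1 (one_mem _) _ (neg_mem hi)))
  · rw [single_mul_single, add_neg_cancel]
    by_cases hc : c i = 0
    · rw [hc, zero_mul, single_eq_zero]
      exact zero_mem _
    · rw [SetLike.mem_coe, mem_integers, mul_one, orderTop_single hc]
      exact le_rfl
  · rw [single_mul_single, add_neg_cancel, mul_one, coeff_single_same]

variable (hK : Hensel (hahnVal k G) K) (hinf : ¬ FiniteDimensional K (monomialField K c γ))
include hK hinf

theorem immediate_monomialField {y : HahnSeries G k} (hy : y ∈ adjoin K {powerSeries c γ hγ}) :
    ∃ d ∈ (monomialField K c γ).toSubfield, LeadEq (hahnVal k G) y d := by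
  obtain ⟨E, hLE, hz, -, him, -⟩ := exists_hensel_extension hmon hsep htame hK hγ hinf
  refine him y (adjoin_le ?_ (Set.singleton_subset_iff.2 hz) hy)
  exact fun x hx => hLE ((monomialField K c γ).algebraMap_mem ⟨x, hx⟩)

/-- K(z)^h lies in the henselian field E, in which the monomial field is relatively algebraically
closed. Conversely the monomials are algebraic over K and lie in K(z)^h. -/
theorem implicitConstantField_eq :
    implicitConstantField K (powerSeries c γ hγ) = (monomialField K c γ).toSubfield := by
  obtain ⟨E, hLE, hz, hE, -, hac⟩ := exists_hensel_extension hmon hsep htame hK hγ hinf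
  have hKE : K ≤ E := fun x hx => hLE ((monomialField K c γ).algebraMap_mem ⟨x, hx⟩)
  refine le_antisymm ?_ (le_inf (fun (x : HahnSeries G k) (hx : x ∈ monomialField K c γ) => ?_)
    (monomialField_le_henselization hmon hsep htame hγ))
  · have hle : henselization (adjoin K {powerSeries c γ hγ}) ≤ E :=
      sInf_le ⟨adjoin_le hKE (Set.singleton_subset_iff.2 hz), isHenselian_iff.2 hE⟩
    rintro x ⟨hx, hxh⟩
    refine hac x (hle hxh) ?_
    have h1 : IsAlgebraic K x := mem_algebraicClosure_iff.1 hx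
    exact h1.tower_top (monomialField K c γ)
  · exact mem_algebraicClosure_iff.2 (isAlgebraic_of_mem_monomialField hmon hsep htame hx)

theorem valueGroup_adjoin_powerSeries :
    valueGroup (adjoin K {powerSeries c γ hγ}) = exponentGroup K c γ := by
  refine le_antisymm ?_ (sup_le (valueGroup_mono (le_adjoin _ _)) ((AddSubgroup.closure_le _).2 ?_))
  · refine (valueGroup_le_of_immediate fun y hy =>
      immediate_monomialField hmon hsep htame hγ hK hinf hy).trans ?_
    rintro _ ⟨y, hy, hy0, rfl⟩
    exact (lead_mem_of_mem_monomialField hmon hsep htame hy hy0).1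
  · rintro _ ⟨i, hi, rfl⟩
    exact exponent_mem_valueGroup hmon hsep htame hγ hi

/-- The condition on the exponents serves only the lower bound, where c i is the residue of c_i
t^{γ_i} multiplied by t^{-γ_i} in K; the upper bound comes from leading coefficients. -/
theorem residueField_adjoin_powerSeries (hv : ∀ i, γ i ∈ valueGroup K) :
    residueField (adjoin K {powerSeries c γ hγ}) = (constantField K c).toSubfield := by
  refine le_antisymm ?_ ?_
  · refine (residueField_le_of_immediate fun y hy =>
      immediate_monomialField hmon hsep htame hγ hK hinf hy).trans ?_
    rintro _ ⟨y, hy, rfl⟩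
    by_cases h0 : y.coeff 0 = 0
    · rw [h0]; exact zero_mem _
    have hy0 : y ≠ 0 := by
      rintro rfl
      exact h0 rfl
    have ho : y.order = 0 := by
      rw [← WithTop.coe_inj, order_eq_orderTop_of_ne_zero hy0]
      exact le_antisymm (orderTop_le_of_coeff_ne_zero h0) hy.2
    have := (lead_mem_of_mem_monomialField hmon hsep htame hy.1 hy0).2
    rwa [leadingCoeff_eq, ho] at this
  · let E : IntermediateField (residueField K) k :=
      { residueField (adjoin K {powerSeries c γ hγ}) with
        algebraMap_mem' := fun a => residueField_mono (le_adjoin _ _) a.2 }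
    refine (IntermediateField.adjoin_le_iff (T := E)).2 ?_
    rintro _ ⟨i, rfl⟩
    exact coeff_mem_residueField_of_exponent_mem hmon hsep htame hγ i (hv i)

end

end PowerSeriesField

theorem mainTheorem12 {k G : Type*} [Field k] [AddCommGroup G] [LinearOrder G]
    [IsOrderedAddMonoid G]
    (K : Subfield (HahnSeries G k))
    (hK : PowerSeriesField.IsHenselian K)
    (hmon : ∀ a ∈ PowerSeriesField.residueField K, ∀ g ∈ PowerSeriesField.valueGroup K,
      HahnSeries.single g a ∈ K)
    (c : ℕ → k) (γ : ℕ → G) (hγ : StrictMono γ)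
    (hsep : ∀ i, IsSeparable (PowerSeriesField.residueField K) (c i))
    (htame : ∀ i, ∃ e : ℕ, 0 < e ∧
      e.Coprime (ringExpChar (PowerSeriesField.residueField K)) ∧
      e • γ i ∈ PowerSeriesField.valueGroup K)
    (z : HahnSeries G k) (hz : z = PowerSeriesField.powerSeries c γ hγ)
    (Kz : Subfield (HahnSeries G k)) (hKz : Kz = PowerSeriesField.adjoin K {z})
    (KM : Subfield (HahnSeries G k))
    (hKM : KM = PowerSeriesField.adjoin K (Set.range fun i => HahnSeries.single (γ i) (c i)))
    (Γ : AddSubgroup G)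
    (hΓ : Γ = PowerSeriesField.valueGroup K ⊔ AddSubgroup.closure {g | ∃ i, c i ≠ 0 ∧ γ i = g})
    (kc : IntermediateField (PowerSeriesField.residueField K) k)
    (hkc : kc = IntermediateField.adjoin (PowerSeriesField.residueField K) (Set.range c)) :
    KM ≤ PowerSeriesField.henselization Kz ∧
    (∀ i, c i ≠ 0 → γ i ∈ PowerSeriesField.valueGroup Kz) ∧
    ((∀ i, γ i ∈ PowerSeriesField.valueGroup K) →
      ∀ i, c i ∈ PowerSeriesField.residueField Kz) ∧
    ((Infinite (Γ ⧸ (PowerSeriesField.valueGroup K).addSubgroupOf Γ) ∨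
        ¬ FiniteDimensional (PowerSeriesField.residueField K) kc) →
      Transcendental K z ∧
      PowerSeriesField.implicitConstantField K z = KM ∧
      PowerSeriesField.valueGroup Kz = Γ ∧
      ((∀ i, γ i ∈ PowerSeriesField.valueGroup K) →
        PowerSeriesField.residueField Kz = kc.toSubfield)) := by
  subst hz hKz hKM hΓ hkc
  have hH := PowerSeriesField.isHenselian_iff.1 hK
  refine ⟨PowerSeriesField.monomialField_le_henselization hmon hsep htame hγ,
    fun i hi => PowerSeriesField.exponent_mem_valueGroup hmon hsep htame hγ hi,
    fun hv i => PowerSeriesField.coeff_mem_residueField_of_exponent_mem hmon hsep htame hγ i (hv i),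
    fun h => ?_⟩
  have hinf := PowerSeriesField.not_finiteDimensional_monomialField (γ := γ) hmon hsep h
  exact ⟨PowerSeriesField.transcendental_powerSeries hmon hsep htame hγ hinf,
    PowerSeriesField.implicitConstantField_eq hmon hsep htame hγ hH hinf,
    PowerSeriesField.valueGroup_adjoin_powerSeries hmon hsep htame hγ hH hinf,
    PowerSeriesField.residueField_adjoin_powerSeries hmon hsep htame hγ hH hinf⟩
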